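/- Let $\Bbbk$ be an algebraically closed field. A $\Bbbk$-additive category is a category whose Hom-sets are $\Bbbk$-modules with $\Bbbk$-bilinear composition and in which every finite family of objects has a direct sum. An object $i$ of such a category is simple if $\mathrm{End}(i)$ is a free $\Bbbk$-module of rank $1$. The category is split semisimple if every object is a finite direct sum of simple objects and $\mathrm{Hom}(i,j)=0$ for all non-isomorphic simple objects $i,j$; it is finite if moreover the set of isomorphism classes of simple objects is finite. A pivotal category is a monoidal category in which every object $X$ has an object $X^*$ that is both a left dual (via $\mathrm{ev}_X\colon X^*\otimes X\to\mathbb 1$, $\mathrm{coev}_X\colon\mathbb 1\to X\otimes X^*$) and a right dual (via $\widetilde{\mathrm{ev}}_X\colon X\otimes X^*\to\mathbb 1$, $\widetilde{\mathrm{coev}}_X\colon\mathbb 1\to X^*\otimes X$), such that the left and right dual functors coincide as monoidal functors. Set $\dim_l(X)=\mathrm{ev}_X\,\widetilde{\mathrm{coev}}_X$ and $\dim_r(X)=\widetilde{\mathrm{ev}}_X\,\mathrm{coev}_X$ in $\mathrm{End}(\mathbb 1)$. The dimension of a finite split semisimple pivotal category $\mathcal D$ is $\dim(\mathcal D)=\sum_{i\in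 I}\dim_l(i)\dim_r(i)\in\mathrm{End}_{\mathcal D}(\mathbb 1)$, where $I$ is a set of representatives of the isomorphism classes of simple objects of $\mathcal D$. Let $\mathcal C$ be a $\Bbbk$-additive pivotal category (with $\Bbbk$-bilinear monoidal product) which is split semisimple and whose unit object $\mathbb 1$ is simple. Let $\mathcal D$ be a (not necessarily full) $\Bbbk$-linear pivotal subcategory of $\mathcal C$, that is, a $\Bbbk$-linear monoidal subcategory stable under duality and containing the morphisms $\mathrm{ev}_X,\mathrm{coev}_X,\widetilde{\mathrm{ev}}_X,\widetilde{\mathrm{coev}}_X$ for all $X\in\mathcal D$. Suppose that $\mathcal D$ is finite split semisimple and $\dim(\mathcal D)\neq 0$. Let $\mathcal Z(\mathcal C;\mathcal D)$ be the relative center: its objects are the pairs $(A,\sigma)$, where $A\in\mathcal C$ and $\sigma=\{\sigma_X\colon A\otimes X\to X\otimes A\}_{X\in\mathcal D}$ is a family of isomorphisms in $\mathcal C$, natural with respect to the morphisms of $\mathcal D$, such that $\sigma_{X\otimes Y}=(\mathrm{id}_X\otimes\sigma_Y)(\sigma_X\otimes\mathrm{id}_Y)$ (up to associativity constraints) for all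 $X,Y\in\mathcal D$; a morphism $(A,\sigma)\to(A',\sigma')$ is a morphism $f\colon A\to A'$ of $\mathcal C$ such that $(\mathrm{id}_X\otimes f)\sigma_X=\sigma'_X(f\otimes\mathrm{id}_X)$ for all $X\in\mathcal D$. Then $\mathcal Z(\mathcal C;\mathcal D)$ is a $\Bbbk$-additive split semisimple category. -/

import Mathlib

open CategoryTheory CategoryTheory.Limits MonoidalCategory

universe w v u

/-- A pivotal category: every object `X` has a dual object `dual X` which is at the same time
a left dual (with `ev X : dual X ⊗ X ⟶ 𝟙_ C` and `coev X : 𝟙_ C ⟶ X ⊗ dual X`) and a right dual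
(with `evR X : X ⊗ dual X ⟶ 𝟙_ C` and `coevR X : 𝟙_ C ⟶ dual X ⊗ X`), such that the left and the
right dual functors are equal as monoidal functors: on morphisms (`dual_map`) and in their
monoidal constraints (`dual_unit` and `dual_tensor`). -/
class PivotalCategory (C : Type u) [Category.{v} C] [MonoidalCategory C] where
  /-- the dual object -/
  dual : C → C
  /-- `dual X` is a left dual of `X` -/
  leftPairing : ∀ X : C, ExactPairing X (dual X)
  /-- `dual X` is a right dual of `X` -/
  rightPairing : ∀ X : C, ExactPairing (dual X) X
  dual_map : ∀ {X Y : C} (f : X ⟶ Y),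
    (ρ_ (dual Y)).inv ≫ dual Y ◁ (leftPairing X).coevaluation' ≫
        dual Y ◁ f ▷ dual X ≫ (α_ (dual Y) Y (dual X)).inv ≫
        (leftPairing Y).evaluation' ▷ dual X ≫ (λ_ (dual X)).hom =
      (λ_ (dual Y)).inv ≫ (rightPairing X).coevaluation' ▷ dual Y ≫
        (dual X ◁ f) ▷ dual Y ≫ (α_ (dual X) Y (dual Y)).hom ≫
        dual X ◁ (rightPairing Y).evaluation' ≫ (ρ_ (dual X)).hom
  dual_unit :
    (leftPairing (𝟙_ C)).coevaluation' ≫ (λ_ (dual (𝟙_ C))).hom =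
      (rightPairing (𝟙_ C)).coevaluation' ≫ (ρ_ (dual (𝟙_ C))).hom
  dual_tensor : ∀ X Y : C,
    (𝟙 (dual X ⊗ dual Y) ⊗≫
      (dual X ⊗ dual Y) ◁ (leftPairing (Y ⊗ X)).coevaluation' ⊗≫
      dual X ◁ (leftPairing Y).evaluation' ▷ (X ⊗ dual (Y ⊗ X)) ⊗≫
      (leftPairing X).evaluation' ▷ dual (Y ⊗ X) ⊗≫
      𝟙 (dual (Y ⊗ X))) =
    (𝟙 (dual X ⊗ dual Y) ⊗≫
      (rightPairing (Y ⊗ X)).coevaluation' ▷ (dual X ⊗ dual Y) ⊗≫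
      (dual (Y ⊗ X) ⊗ Y) ◁ (rightPairing X).evaluation' ▷ dual Y ⊗≫
      dual (Y ⊗ X) ◁ (rightPairing Y).evaluation' ⊗≫
      𝟙 (dual (Y ⊗ X)))

namespace PivotalCategory

section

variable {C : Type u} [Category.{v} C] [MonoidalCategory C] [PivotalCategory C]

/-- The left evaluation. -/
def ev (X : C) : dual X ⊗ X ⟶ 𝟙_ C := (leftPairing X).evaluation'

/-- The left coevaluation. -/
def coev (X : C) : 𝟙_ C ⟶ X ⊗ dual X := (leftPairing X).coevaluation'

/-- The right evaluation. -/
def evR (X : C) : X ⊗ dual X ⟶ 𝟙_ C := (rightPairing X).evaluation'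

/-- The right coevaluation. -/
def coevR (X : C) : 𝟙_ C ⟶ dual X ⊗ X := (rightPairing X).coevaluation'

/-- The left trace of an endomorphism. -/
def trL {X : C} (g : X ⟶ X) : End (𝟙_ C) := coevR X ≫ dual X ◁ g ≫ ev X

/-- The right trace of an endomorphism. -/
def trR {X : C} (g : X ⟶ X) : End (𝟙_ C) := coev X ≫ g ▷ dual X ≫ evR X

/-- The left dimension of an object. -/
def dimL (X : C) : End (𝟙_ C) := trL (𝟙 X)

/-- The right dimension of an object. -/
def dimR (X : C) : End (𝟙_ C) := trR (𝟙 X)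

end

end PivotalCategory

section SplitSemisimple

variable (k : Type w) [CommRing k] {C : Type u} [Category.{v} C] [Preadditive C] [Linear k C]

/-- An object `X` of a `k`-linear category is simple (in the split sense) if `End X` is a free
`k`-module of rank one. -/
def IsSplitSimple (X : C) : Prop :=
  Module.Free k (X ⟶ X) ∧ Module.rank k (X ⟶ X) = 1

variable (C)

/-- A `k`-linear category is split semisimple if it has finite direct sums, every object is a
finite direct sum of simple objects, and all morphisms between non-isomorphic simple objects
vanish. -/
structure IsSplitSemisimple : Prop where
  hasFiniteBiproducts : HasFiniteBiproducts C
  exists_decomposition : ∀ X : C, ∃ (n : ℕ) (S : Fin n → C),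
    (∀ a, IsSplitSimple k (S a)) ∧ ∃ b : Bicone S, Nonempty b.IsBilimit ∧ Nonempty (X ≅ b.pt)
  hom_eq_zero : ∀ X Y : C, IsSplitSimple k X → IsSplitSimple k Y → IsEmpty (X ≅ Y) →
    ∀ f : X ⟶ Y, f = 0

/-- The isomorphism classes of simple objects; the elements `c.1.out` form a representative set
of simple objects. -/
def SimpleClasses : Type u :=
  {c : Quotient (isIsomorphicSetoid C) // IsSplitSimple k c.out}

/-- The dimension of a pivotal category with finitely many isomorphism classes of simple objects:
the sum of `dimL i * dimR i`, where `i` runs over a representative set of simple objects. -/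
noncomputable def pivotalDim [MonoidalCategory C] [PivotalCategory C] : End (𝟙_ C) :=
  ∑ᶠ c : SimpleClasses k C, PivotalCategory.dimL c.1.out * PivotalCategory.dimR c.1.out

end SplitSemisimple

open PivotalCategory in
/-- A (not necessarily full) `k`-linear pivotal subcategory of a `k`-linear pivotal category `C`:
a class of objects and, for all objects `X`, `Y` of this class, a submodule of `X ⟶ Y`, which
contain the identities and are stable under composition, tensor product and duality and
contain the structural morphisms of the pivotal category `C`. The values of `hom` at objects
outside the class `obj` are irrelevant. -/
structure LinearPivotalSubcategory (k : Type w) [CommRing k] (C : Type u) [Category.{v} C]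
    [Preadditive C] [Linear k C] [MonoidalCategory C] [PivotalCategory C] where
  /-- the objects of the subcategory -/
  obj : C → Prop
  /-- the morphisms of the subcategory -/
  hom : ∀ X Y : C, Submodule k (X ⟶ Y)
  id_mem : ∀ {X : C}, obj X → 𝟙 X ∈ hom X X
  comp_mem : ∀ {X Y Z : C}, obj X → obj Y → obj Z → ∀ {f : X ⟶ Y} {g : Y ⟶ Z},
    f ∈ hom X Y → g ∈ hom Y Z → f ≫ g ∈ hom X Z
  unit_obj : obj (𝟙_ C)
  tensor_obj : ∀ {X Y : C}, obj X → obj Y → obj (X ⊗ Y)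
  tensor_mem : ∀ {X Y X' Y' : C}, obj X → obj Y → obj X' → obj Y' →
    ∀ {f : X ⟶ Y} {g : X' ⟶ Y'}, f ∈ hom X Y → g ∈ hom X' Y' →
      f ⊗ₘ g ∈ hom (X ⊗ X') (Y ⊗ Y')
  associator_hom_mem : ∀ {X Y Z : C}, obj X → obj Y → obj Z →
    (α_ X Y Z).hom ∈ hom ((X ⊗ Y) ⊗ Z) (X ⊗ Y ⊗ Z)
  associator_inv_mem : ∀ {X Y Z : C}, obj X → obj Y → obj Z →
    (α_ X Y Z).inv ∈ hom (X ⊗ Y ⊗ Z) ((X ⊗ Y) ⊗ Z)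
  leftUnitor_hom_mem : ∀ {X : C}, obj X → (λ_ X).hom ∈ hom (𝟙_ C ⊗ X) X
  leftUnitor_inv_mem : ∀ {X : C}, obj X → (λ_ X).inv ∈ hom X (𝟙_ C ⊗ X)
  rightUnitor_hom_mem : ∀ {X : C}, obj X → (ρ_ X).hom ∈ hom (X ⊗ 𝟙_ C) X
  rightUnitor_inv_mem : ∀ {X : C}, obj X → (ρ_ X).inv ∈ hom X (X ⊗ 𝟙_ C)
  dual_obj : ∀ {X : C}, obj X → obj (dual X)
  ev_mem : ∀ {X : C}, obj X → ev X ∈ hom (dual X ⊗ X) (𝟙_ C)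
  coev_mem : ∀ {X : C}, obj X → coev X ∈ hom (𝟙_ C) (X ⊗ dual X)
  evR_mem : ∀ {X : C}, obj X → evR X ∈ hom (X ⊗ dual X) (𝟙_ C)
  coevR_mem : ∀ {X : C}, obj X → coevR X ∈ hom (𝟙_ C) (dual X ⊗ X)

namespace LinearPivotalSubcategory

variable {k : Type w} [CommRing k] {C : Type u} [Category.{v} C] [Preadditive C] [Linear k C]
  [MonoidalCategory C] [PivotalCategory C] (D : LinearPivotalSubcategory k C)

/-- The objects of the subcategory. -/
structure Obj where
  /-- the underlying object -/
  val : C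
  property : D.obj val

instance : Category.{v} D.Obj where
  Hom X Y := D.hom X.val Y.val
  id X := ⟨𝟙 X.val, D.id_mem X.property⟩
  comp {X Y Z} f g := ⟨f.1 ≫ g.1, D.comp_mem X.property Y.property Z.property f.2 g.2⟩
  id_comp f := Subtype.ext (Category.id_comp f.1)
  comp_id f := Subtype.ext (Category.comp_id f.1)
  assoc f g h := Subtype.ext (Category.assoc f.1 g.1 h.1)

instance : Preadditive D.Obj where
  homGroup X Y := inferInstanceAs (AddCommGroup (D.hom X.val Y.val))
  add_comp _ _ _ f f' g := Subtype.ext (Preadditive.add_comp _ _ _ f.1 f'.1 g.1)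
  comp_add _ _ _ f g g' := Subtype.ext (Preadditive.comp_add _ _ _ f.1 g.1 g'.1)

instance : Linear k D.Obj where
  homModule X Y := inferInstanceAs (Module k (D.hom X.val Y.val))
  smul_comp _ _ _ r f g := Subtype.ext (Linear.smul_comp _ _ _ r f.1 g.1)
  comp_smul _ _ _ f r g := Subtype.ext (Linear.comp_smul _ _ _ f.1 r g.1)

/-- An isomorphism of `C` belonging to `D` together with its inverse. -/
def isoMk {X Y : D.Obj} (e : X.val ≅ Y.val) (h : e.hom ∈ D.hom X.val Y.val)
    (h' : e.inv ∈ D.hom Y.val X.val) : X ≅ Y where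
  hom := ⟨e.hom, h⟩
  inv := ⟨e.inv, h'⟩
  hom_inv_id := Subtype.ext e.hom_inv_id
  inv_hom_id := Subtype.ext e.inv_hom_id

theorem whiskerLeft_mem {X Y Z : C} (hX : D.obj X) (hY : D.obj Y) (hZ : D.obj Z) {f : Y ⟶ Z}
    (hf : f ∈ D.hom Y Z) : X ◁ f ∈ D.hom (X ⊗ Y) (X ⊗ Z) := by
  rw [← id_tensorHom]
  exact D.tensor_mem hX hX hY hZ (D.id_mem hX) hf

theorem whiskerRight_mem {X Y Z : C} (hX : D.obj X) (hY : D.obj Y) (hZ : D.obj Z) {f : Y ⟶ Z}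
    (hf : f ∈ D.hom Y Z) : f ▷ X ∈ D.hom (Y ⊗ X) (Z ⊗ X) := by
  rw [← tensorHom_id]
  exact D.tensor_mem hY hZ hX hX hf (D.id_mem hX)

instance : MonoidalCategory D.Obj where
  tensorObj X Y := ⟨X.val ⊗ Y.val, D.tensor_obj X.property Y.property⟩
  whiskerLeft X Y Z f := ⟨X.val ◁ f.1, D.whiskerLeft_mem X.property Y.property Z.property f.2⟩
  whiskerRight {Y Z} f X :=
    ⟨f.1 ▷ X.val, D.whiskerRight_mem X.property Y.property Z.property f.2⟩
  tensorHom {X Y X' Y'} f g := ⟨f.1 ⊗ₘ g.1,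
    D.tensor_mem X.property Y.property X'.property Y'.property f.2 g.2⟩
  tensorUnit := ⟨𝟙_ C, D.unit_obj⟩
  associator X Y Z := D.isoMk (α_ X.val Y.val Z.val)
    (D.associator_hom_mem X.property Y.property Z.property)
    (D.associator_inv_mem X.property Y.property Z.property)
  leftUnitor X := D.isoMk (λ_ X.val)
    (D.leftUnitor_hom_mem X.property) (D.leftUnitor_inv_mem X.property)
  rightUnitor X := D.isoMk (ρ_ X.val)
    (D.rightUnitor_hom_mem X.property) (D.rightUnitor_inv_mem X.property)
  tensorHom_def f g := Subtype.ext (MonoidalCategory.tensorHom_def f.1 g.1)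
  id_tensorHom_id X Y := Subtype.ext (MonoidalCategory.id_tensorHom_id X.val Y.val)
  tensorHom_comp_tensorHom f g h l :=
    Subtype.ext (MonoidalCategory.tensorHom_comp_tensorHom f.1 g.1 h.1 l.1)
  whiskerLeft_id X Y := Subtype.ext (MonoidalCategory.whiskerLeft_id X.val Y.val)
  id_whiskerRight X Y := Subtype.ext (MonoidalCategory.id_whiskerRight X.val Y.val)
  associator_naturality f g h :=
    Subtype.ext (MonoidalCategory.associator_naturality f.1 g.1 h.1)
  leftUnitor_naturality f := Subtype.ext (MonoidalCategory.leftUnitor_naturality f.1)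
  rightUnitor_naturality f := Subtype.ext (MonoidalCategory.rightUnitor_naturality f.1)
  pentagon W X Y Z := Subtype.ext (MonoidalCategory.pentagon W.val X.val Y.val Z.val)
  triangle X Y := Subtype.ext (MonoidalCategory.triangle X.val Y.val)

instance : PivotalCategory D.Obj where
  dual X := ⟨PivotalCategory.dual X.val, D.dual_obj X.property⟩
  leftPairing X :=
    { coevaluation' := ⟨PivotalCategory.coev X.val, D.coev_mem X.property⟩
      evaluation' := ⟨PivotalCategory.ev X.val, D.ev_mem X.property⟩
      coevaluation_evaluation' :=
        Subtype.ext (PivotalCategory.leftPairing X.val).coevaluation_evaluation'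
      evaluation_coevaluation' :=
        Subtype.ext (PivotalCategory.leftPairing X.val).evaluation_coevaluation' }
  rightPairing X :=
    { coevaluation' := ⟨PivotalCategory.coevR X.val, D.coevR_mem X.property⟩
      evaluation' := ⟨PivotalCategory.evR X.val, D.evR_mem X.property⟩
      coevaluation_evaluation' :=
        Subtype.ext (PivotalCategory.rightPairing X.val).coevaluation_evaluation'
      evaluation_coevaluation' :=
        Subtype.ext (PivotalCategory.rightPairing X.val).evaluation_coevaluation' }
  dual_map f := Subtype.ext (PivotalCategory.dual_map f.1)
  dual_unit := Subtype.ext PivotalCategory.dual_unit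
  dual_tensor X Y := Subtype.ext (PivotalCategory.dual_tensor X.val Y.val)

end LinearPivotalSubcategory

/-- The (left) center of `C` relative to `D`: its objects are the half braidings of `C` relative
to `D`, that is, the objects `A` of `C` endowed with isomorphisms `A ⊗ X ≅ X ⊗ A` for `X` in `D`
which are natural with respect to the morphisms of `D` and multiplicative in `X`. -/
structure RelativeCenter {k : Type w} [CommRing k] {C : Type u} [Category.{v} C] [Preadditive C]
    [Linear k C] [MonoidalCategory C] [PivotalCategory C] (D : LinearPivotalSubcategory k C) where
  /-- the underlying object of `C` -/
  obj : C
  /-- the half braiding -/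
  σ : ∀ X : D.Obj, obj ⊗ X.val ≅ X.val ⊗ obj
  naturality : ∀ {X Y : D.Obj} (f : X ⟶ Y),
    obj ◁ f.1 ≫ (σ Y).hom = (σ X).hom ≫ f.1 ▷ obj
  monoidal : ∀ X Y : D.Obj, (σ (X ⊗ Y)).hom =
    (α_ obj X.val Y.val).inv ≫ (σ X).hom ▷ Y.val ≫ (α_ X.val obj Y.val).hom ≫
      X.val ◁ (σ Y).hom ≫ (α_ X.val Y.val obj).inv

namespace RelativeCenter

variable {k : Type w} [CommRing k] {C : Type u} [Category.{v} C] [Preadditive C] [Linear k C]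
  [MonoidalCategory C] [PivotalCategory C] {D : LinearPivotalSubcategory k C}

/-- A morphism of half braidings. -/
@[ext]
structure Hom (A B : RelativeCenter D) where
  /-- the underlying morphism of `C` -/
  f : A.obj ⟶ B.obj
  comm : ∀ X : D.Obj, (A.σ X).hom ≫ X.val ◁ f = f ▷ X.val ≫ (B.σ X).hom

instance : Category.{v} (RelativeCenter D) where
  Hom A B := Hom A B
  id A := ⟨𝟙 A.obj, fun X => by simp⟩
  comp f g := ⟨f.f ≫ g.f, fun X => by
    rw [MonoidalCategory.whiskerLeft_comp, ← Category.assoc, f.comm, Category.assoc, g.comm,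
      comp_whiskerRight, Category.assoc]⟩
  id_comp f := Hom.ext (Category.id_comp f.f)
  comp_id f := Hom.ext (Category.comp_id f.f)
  assoc f g h := Hom.ext (Category.assoc f.f g.f h.f)

variable [MonoidalPreadditive C] [MonoidalLinear k C]

/-- The morphisms of half braidings form a submodule of the morphisms of `C`. -/
def homSubmodule (A B : RelativeCenter D) : Submodule k (A.obj ⟶ B.obj) where
  carrier := {f | ∀ X : D.Obj, (A.σ X).hom ≫ X.val ◁ f = f ▷ X.val ≫ (B.σ X).hom}
  add_mem' {f g} hf hg X := by simp [hf X, hg X]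
  zero_mem' X := by simp
  smul_mem' r f hf X := by simp [hf X]

/-- Morphisms of half braidings as elements of a submodule. -/
def homEquiv (A B : RelativeCenter D) : (A ⟶ B) ≃ homSubmodule A B where
  toFun f := ⟨f.f, f.comm⟩
  invFun f := ⟨f.1, f.2⟩
  left_inv _ := rfl
  right_inv _ := rfl

/-- Addition and scalar multiplication of morphisms are those of `C`. -/
instance : Preadditive (RelativeCenter D) where
  homGroup A B := (homEquiv A B).addCommGroup
  add_comp _ _ _ f f' g := Hom.ext (Preadditive.add_comp _ _ _ f.f f'.f g.f)
  comp_add _ _ _ f g g' := Hom.ext (Preadditive.comp_add _ _ _ f.f g.f g'.f)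

instance : Linear k (RelativeCenter D) where
  homModule A B := (homEquiv A B).module k
  smul_comp _ _ _ r f g := Hom.ext (Linear.smul_comp _ _ _ r f.f g.f)
  comp_smul _ _ _ f r g := Hom.ext (Linear.comp_smul _ _ _ f.f r g.f)

end RelativeCenter

/-! ### Split semisimplicity and von Neumann regularity in linear categories. -/

section LinearCategory

variable {k : Type w} [Field k] {C : Type u} [Category.{v} C] [Preadditive C] [Linear k C]

/-! The argument is Maschke's theorem, with the sum over a group replaced by a weighted sum over the
simple objects of `D`. Given half braidings on `A` and `B` and a morphism `f` of `C` between the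
underlying objects, conjugation by the half braidings at `X` gives `twist f X` from `A ⊗ X` to `B ⊗
X`. Its right partial traces over the simple objects of `D`, weighted by their left dimensions, add
up to `average`. This operation lands in the morphisms of half braidings (`average_mem`), commutes
with composition by such morphisms on either side, and multiplies such a morphism by `dim D`
(`average_hom`). Now let `f` be a morphism of half braidings and `g` a morphism of `C` with `f ≫ g ≫
f = f`. With `g'` the average of `g`, `f ≫ g' ≫ f` is the average of `f ≫ g ≫ f = f`, that is `dim
D` times `f`. As `dim D` is invertible, every morphism of the relative center is von Neumann
regular.

The heart is `average_mem`. Decomposing `X ⊗ i` into simples `j` on one side and `dual j ⊗ X` into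
simples `dual i` on the other turns both sides of the braiding condition into contractions of `twist
f j` with tensors in `Hom(X, j ⊗ dual i) ⊗ Hom(j ⊗ dual i, X)`. These tensors agree up to the left
dimensions of `i` and `j` (`smul_sum_bend_eq`), which is what the weights compensate.

The relative center inherits from `C` finite direct sums, split idempotents and finite-dimensional
morphism spaces. Over an algebraically closed field, these together with regularity force split
semisimplicity (`isSplitSemisimple_of_pseudoinverse`): a non-scalar endomorphism produces a proper
idempotent, and summands are split off until all are simple. -/

theorem isSplitSimple_iff {X : C} :
    IsSplitSimple k X ↔ 𝟙 X ≠ 0 ∧ ∀ f : X ⟶ X, ∃ c : k, f = c • 𝟙 X := by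
  constructor
  · rintro ⟨-, h⟩
    obtain ⟨v₀, hv₀, hv⟩ := rank_eq_one_iff.1 h
    have h1 : 𝟙 X ≠ 0 := fun h0 => hv₀ (by rw [← Category.comp_id v₀, h0, comp_zero])
    refine ⟨h1, fun f => ?_⟩
    obtain ⟨r, hr⟩ := hv (𝟙 X)
    obtain ⟨s, hs⟩ := hv f
    have hr0 : r ≠ 0 := by
      rintro rfl
      exact h1 (by rw [← hr, zero_smul])
    refine ⟨s * r⁻¹, ?_⟩
    rw [← hr, smul_smul, mul_assoc, inv_mul_cancel₀ hr0, mul_one, hs]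
  · rintro ⟨h1, h⟩
    refine ⟨inferInstance, rank_eq_one_iff.2 ⟨𝟙 X, h1, fun f => ?_⟩⟩
    obtain ⟨c, hc⟩ := h f
    exact ⟨c, hc.symm⟩

theorem IsSplitSimple.of_iso {X Y : C} (hX : IsSplitSimple k X) (e : X ≅ Y) :
    IsSplitSimple k Y := by
  rw [isSplitSimple_iff] at hX ⊢
  refine ⟨fun h => hX.1 ?_, fun f => ?_⟩
  · rw [← e.hom_inv_id, ← Category.id_comp e.inv, h, zero_comp, comp_zero]
  · obtain ⟨c, hc⟩ := hX.2 (e.hom ≫ f ≫ e.inv)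
    refine ⟨c, ?_⟩
    have : f = e.inv ≫ (e.hom ≫ f ≫ e.inv) ≫ e.hom := by simp
    rw [this, hc]
    simp

theorem IsSplitSemisimple.exists_retraction (hC : IsSplitSemisimple k C) {X Y : C}
    (hX : IsSplitSimple k X) (hY : IsSplitSimple k Y) {f : X ⟶ Y} (hf : f ≠ 0) :
    ∃ g : Y ⟶ X, f ≫ g = 𝟙 X := by
  have hne : Nonempty (X ≅ Y) := by
    by_contra h
    exact hf (hC.hom_eq_zero X Y hX hY (not_nonempty_iff.1 h) f)
  obtain ⟨e⟩ := hne
  obtain ⟨c, hc⟩ := (isSplitSimple_iff.1 hX).2 (f ≫ e.inv)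
  have hc0 : c ≠ 0 := by
    rintro rfl
    apply hf
    rw [← Category.comp_id f, ← e.inv_hom_id, ← Category.assoc, hc, zero_smul, zero_comp]
  exact ⟨c⁻¹ • e.inv, by rw [Linear.comp_smul, hc, smul_smul, inv_mul_cancel₀ hc0, one_smul]⟩

variable (k) in
/-- A decomposition of an object as a finite direct sum of simple objects. -/
structure SimpleDecomposition (X : C) where
  /-- the index type -/
  J : Type
  [fintype : Fintype J]
  /-- the simple summands -/
  S : J → C
  simple : ∀ a, IsSplitSimple k (S a)
  /-- the inclusions -/
  ι : ∀ a, S a ⟶ X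
  /-- the projections -/
  π : ∀ a, X ⟶ S a
  ι_π_self : ∀ a, ι a ≫ π a = 𝟙 (S a)
  ι_π_ne : ∀ a b, a ≠ b → ι a ≫ π b = 0
  total : ∑ a, π a ≫ ι a = 𝟙 X

attribute [instance] SimpleDecomposition.fintype

theorem IsSplitSemisimple.nonempty_simpleDecomposition (hC : IsSplitSemisimple k C) (X : C) :
    Nonempty (SimpleDecomposition k X) := by
  obtain ⟨n, S, hS, b, ⟨hb⟩, ⟨e⟩⟩ := hC.exists_decomposition X
  refine ⟨⟨Fin n, S, hS, fun a => b.ι a ≫ e.inv, fun a => e.hom ≫ b.π a, fun a => ?_,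
    fun a a' h => ?_, ?_⟩⟩
  · simp
  · simp [bicone_ι_π_ne b h]
  · have := IsBilimit.total hb
    calc ∑ a, (e.hom ≫ b.π a) ≫ b.ι a ≫ e.inv = e.hom ≫ (∑ a, b.π a ≫ b.ι a) ≫ e.inv := by
          simp [Preadditive.sum_comp, Preadditive.comp_sum]
      _ = 𝟙 X := by simp [this]

namespace SimpleDecomposition

/-- The bicone of a decomposition, indexed by `Fin n`. -/
noncomputable def bicone {X : C} (d : SimpleDecomposition k X) :
    Bicone (fun a : Fin (Fintype.card d.J) => d.S ((Fintype.equivFin d.J).symm a)) where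
  pt := X
  π a := d.π _
  ι a := d.ι _
  ι_π a b := by
    split_ifs with h
    · subst h
      simp [d.ι_π_self]
    · exact d.ι_π_ne _ _ fun h' => h ((Fintype.equivFin d.J).symm.injective h')

theorem exists_bicone {X : C} (d : SimpleDecomposition k X) :
    ∃ (n : ℕ) (S : Fin n → C), (∀ a, IsSplitSimple k (S a)) ∧
      ∃ b : Bicone S, Nonempty b.IsBilimit ∧ Nonempty (X ≅ b.pt) := by
  refine ⟨_, _, fun a => d.simple _, d.bicone, ⟨isBilimitOfTotal _ ?_⟩, ⟨Iso.refl X⟩⟩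
  refine Eq.trans ?_ d.total
  exact Equiv.sum_comp (Fintype.equivFin d.J).symm (fun a => d.π a ≫ d.ι a)

/-- The decomposition of a direct sum. -/
def sum {X X₁ X₂ : C} (d₁ : SimpleDecomposition k X₁) (d₂ : SimpleDecomposition k X₂)
    (i₁ : X₁ ⟶ X) (p₁ : X ⟶ X₁) (i₂ : X₂ ⟶ X) (p₂ : X ⟶ X₂) (h₁ : i₁ ≫ p₁ = 𝟙 X₁)
    (h₂ : i₂ ≫ p₂ = 𝟙 X₂) (h₁₂ : i₁ ≫ p₂ = 0) (h₂₁ : i₂ ≫ p₁ = 0)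
    (h : p₁ ≫ i₁ + p₂ ≫ i₂ = 𝟙 X) : SimpleDecomposition k X where
  J := d₁.J ⊕ d₂.J
  S := Sum.elim d₁.S d₂.S
  simple := by rintro (a | a); exacts [d₁.simple a, d₂.simple a]
  ι := fun | .inl a => d₁.ι a ≫ i₁ | .inr a => d₂.ι a ≫ i₂
  π := fun | .inl a => p₁ ≫ d₁.π a | .inr a => p₂ ≫ d₂.π a
  ι_π_self := by
    rintro (a | a)
    · simp [reassoc_of% h₁, d₁.ι_π_self]
    · simp [reassoc_of% h₂, d₂.ι_π_self]
  ι_π_ne := by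
    rintro (a | a) (b | b) hab
    · change (d₁.ι a ≫ i₁) ≫ p₁ ≫ d₁.π b = (0 : d₁.S a ⟶ d₁.S b)
      simp [reassoc_of% h₁, d₁.ι_π_ne a b fun h => hab (by rw [h])]
    · change (d₁.ι a ≫ i₁) ≫ p₂ ≫ d₂.π b = (0 : d₁.S a ⟶ d₂.S b)
      simp [reassoc_of% h₁₂]
    · change (d₂.ι a ≫ i₂) ≫ p₁ ≫ d₁.π b = (0 : d₂.S a ⟶ d₁.S b)
      simp [reassoc_of% h₂₁]
    · change (d₂.ι a ≫ i₂) ≫ p₂ ≫ d₂.π b = (0 : d₂.S a ⟶ d₂.S b)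
      simp [reassoc_of% h₂, d₂.ι_π_ne a b fun h => hab (by rw [h])]
  total := by
    rw [Fintype.sum_sum_type]
    calc _ = p₁ ≫ (∑ a, d₁.π a ≫ d₁.ι a) ≫ i₁ + p₂ ≫ (∑ a, d₂.π a ≫ d₂.ι a) ≫ i₂ := by
          simp [Preadditive.sum_comp, Preadditive.comp_sum]
      _ = 𝟙 X := by simp [d₁.total, d₂.total, h]

/-- A morphism out of a direct sum of simple objects vanishes on some complement of a direct sum
of simple objects which it maps isomorphically onto a direct summand. -/
theorem exists_rank_factorization (hC : IsSplitSemisimple k C) {A B : C}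
    (d : SimpleDecomposition k A) (f : A ⟶ B) :
    ∃ (t : Finset d.J) (g : ∀ a, d.S a ⟶ A) (h : ∀ a, B ⟶ d.S a),
      (∀ a ∈ t, g a ≫ f ≫ h a = 𝟙 _) ∧ (∀ a ∈ t, ∀ b ∈ t, a ≠ b → g a ≫ f ≫ h b = 0) ∧
      f ≫ ∑ a ∈ t, h a ≫ g a ≫ f = f := by
  classical
  -- Gaussian elimination, one summand at a time: `t` indexes the pivots found among the summands in
  -- `s`.
  suffices H : ∀ s : Finset d.J, ∃ t ⊆ s, ∃ (g : ∀ a, d.S a ⟶ A) (h : ∀ a, B ⟶ d.S a),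
      (∀ a ∈ t, g a ≫ f ≫ h a = 𝟙 _) ∧ (∀ a ∈ t, ∀ b ∈ t, a ≠ b → g a ≫ f ≫ h b = 0) ∧
      ∀ b ∈ s, d.ι b ≫ f ≫ ∑ a ∈ t, h a ≫ g a ≫ f = d.ι b ≫ f by
    obtain ⟨t, -, g, h, h₁, h₂, h₃⟩ := H Finset.univ
    refine ⟨t, g, h, h₁, h₂, ?_⟩
    rw [← Category.id_comp (f ≫ _), ← d.total, Preadditive.sum_comp]
    conv_rhs => rw [← Category.id_comp f, ← d.total, Preadditive.sum_comp]
    refine Finset.sum_congr rfl fun b hb => ?_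
    rw [Category.assoc, h₃ b hb, Category.assoc]
  intro s
  induction s using Finset.induction_on with
  | empty => exact ⟨∅, subset_rfl, fun a => d.ι a, fun _ => 0, by simp, by simp, by simp⟩
  | insert c s hc ih =>
    obtain ⟨t, hts, g, h, h₁, h₂, h₃⟩ := ih
    have hct : c ∉ t := fun h' => hc (hts h')
    -- The idempotent of `B` that projects onto the part of the image of `f` covered by the pivots.
    set E : B ⟶ B := ∑ a ∈ t, h a ≫ g a ≫ f with hE
    have hgE : ∀ a ∈ t, g a ≫ f ≫ E = g a ≫ f := by
      intro a ha
      rw [hE, Preadditive.comp_sum, Preadditive.comp_sum, Finset.sum_eq_single a]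
      · have := h₁ a ha
        simp only [← Category.assoc] at this ⊢
        rw [this, Category.id_comp]
      · intro b hb hba
        have := h₂ a ha b hb hba.symm
        simp only [← Category.assoc] at this ⊢
        rw [this, zero_comp, zero_comp]
      · exact fun h => (h ha).elim
    have hEh : ∀ a ∈ t, E ≫ h a = h a := by
      intro a ha
      rw [hE, Preadditive.sum_comp, Finset.sum_eq_single a]
      · simp [h₁ a ha]
      · intro b hb hba
        simp [h₂ b hb a ha hba]
      · exact fun h => (h ha).elim
    have hEE : E ≫ E = E := by
      conv_lhs => enter [2]; rw [hE]
      rw [Preadditive.comp_sum]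
      refine Finset.sum_congr rfl fun a ha => ?_
      rw [← Category.assoc, hEh a ha]
    -- Subtracting the pivot components leaves `gc ≫ f` in the complement of `E`. If it vanishes,
    -- `c` contributes nothing new; otherwise `c` is the next pivot.
    let gc : d.S c ⟶ A := d.ι c - d.ι c ≫ f ≫ ∑ a ∈ t, h a ≫ g a
    have hgc : gc ≫ f = d.ι c ≫ f - d.ι c ≫ f ≫ E := by
      simp [gc, hE, Preadditive.sum_comp]
    by_cases h0 : gc ≫ f = 0
    · refine ⟨t, hts.trans (Finset.subset_insert _ _), g, h, h₁, h₂, fun b hb => ?_⟩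
      rcases Finset.mem_insert.1 hb with rfl | hb
      · rw [hgc, sub_eq_zero] at h0
        exact h0.symm
      · exact h₃ b hb
    obtain ⟨r, hr⟩ : ∃ r : B ⟶ d.S c, (gc ≫ f) ≫ r = 𝟙 _ := by
      obtain ⟨d'⟩ := hC.nonempty_simpleDecomposition B
      obtain ⟨a, ha⟩ : ∃ a, (gc ≫ f) ≫ d'.π a ≠ 0 := by
        by_contra! hall
        apply h0
        rw [← Category.comp_id (gc ≫ f), ← d'.total, Preadditive.comp_sum]
        refine Finset.sum_eq_zero fun a _ => ?_
        rw [← Category.assoc, hall a, zero_comp]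
      obtain ⟨r, hr⟩ := hC.exists_retraction (d.simple c) (d'.simple a) ha
      exact ⟨d'.π a ≫ r, by rw [← Category.assoc, hr]⟩
    have hgcE : gc ≫ f ≫ E = 0 := by
      rw [← Category.assoc, hgc]
      simp [hEE]
    have hne : ∀ a ∈ t, a ≠ c := fun a ha hac => hct (hac ▸ ha)
    -- Replacing `r` by `r - E ≫ r` makes it vanish on the old pivots, without changing its value on
    -- `gc ≫ f`, which `E` kills.
    refine ⟨insert c t, Finset.insert_subset_insert _ hts, Function.update g c gc,
      Function.update h c (r - E ≫ r), ?_, ?_, ?_⟩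
    · intro a ha
      rcases Finset.mem_insert.1 ha with rfl | ha
      · simp only [Function.update_self, Preadditive.comp_sub, reassoc_of% hgcE]
        rw [zero_comp, sub_zero, ← Category.assoc, hr]
      · simp only [Function.update_of_ne (hne a ha)]
        exact h₁ a ha
    · intro a ha b hb hab
      rcases Finset.mem_insert.1 ha with rfl | ha' <;>
        rcases Finset.mem_insert.1 hb with rfl | hb'
      · exact (hab rfl).elim
      · simp only [Function.update_self, Function.update_of_ne (hne b hb')]
        rw [← hEh b hb', reassoc_of% hgcE, zero_comp]
      · simp only [Function.update_self, Function.update_of_ne (hne a ha'), Preadditive.comp_sub]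
        rw [reassoc_of% (hgE a ha'), sub_self]
      · simp only [Function.update_of_ne (hne a ha'), Function.update_of_ne (hne b hb')]
        exact h₂ a ha' b hb' hab
    · have hsum : ∑ a ∈ insert c t, Function.update h c (r - E ≫ r) a ≫
          Function.update g c gc a ≫ f = (r - E ≫ r) ≫ gc ≫ f + E := by
        rw [Finset.sum_insert hct, Function.update_self, Function.update_self, hE]
        congr 1
        refine Finset.sum_congr rfl fun a ha => ?_
        rw [Function.update_of_ne (hne a ha), Function.update_of_ne (hne a ha)]
      intro b hb
      rw [hsum]
      rcases Finset.mem_insert.1 hb with rfl | hb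
      · have : d.ι b ≫ f ≫ (r - E ≫ r) = 𝟙 _ := by
          rw [← hr, hgc]
          simp
        simp only [Preadditive.comp_add]
        rw [reassoc_of% this, hgc, sub_add_cancel]
      · have : d.ι b ≫ f ≫ (r - E ≫ r) = 0 := by
          simp only [Preadditive.comp_sub]
          rw [reassoc_of% (h₃ b hb), sub_self]
        simp only [Preadditive.comp_add]
        rw [reassoc_of% this, h₃ b hb, zero_comp, zero_add]

end SimpleDecomposition

/-- Every morphism of a split semisimple category is von Neumann regular. -/
theorem IsSplitSemisimple.exists_pseudoinverse (hC : IsSplitSemisimple k C) {A B : C}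
    (f : A ⟶ B) : ∃ g : B ⟶ A, f ≫ g ≫ f = f := by
  obtain ⟨d⟩ := hC.nonempty_simpleDecomposition A
  obtain ⟨t, g, h, -, -, hf⟩ := d.exists_rank_factorization hC f
  refine ⟨∑ a ∈ t, h a ≫ g a, ?_⟩
  rw [Preadditive.sum_comp]
  simpa using hf

theorem IsSplitSemisimple.isIdempotentComplete (hC : IsSplitSemisimple k C) :
    IsIdempotentComplete C := by
  refine ⟨fun A e he => ?_⟩
  classical
  have := hC.hasFiniteBiproducts
  obtain ⟨d⟩ := hC.nonempty_simpleDecomposition A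
  obtain ⟨t, g, h, h₁, h₂, h₃⟩ := d.exists_rank_factorization hC e
  have : HasBiproduct fun a : t => d.S a := inferInstance
  -- The pivots of `e` itself form its image; the extra factor `e` in both structure maps is
  -- absorbed by `e ≫ e = e`.
  refine ⟨⨁ fun a : t => d.S a, biproduct.desc fun a => g a ≫ e, biproduct.lift fun a => e ≫ h a,
    ?_, ?_⟩
  · refine biproduct.hom_ext' _ _ fun a => biproduct.hom_ext _ _ fun b => ?_
    by_cases hab : a = b
    · subst hab
      simp [reassoc_of% he, h₁ a a.2]
    · simp [reassoc_of% he, h₂ a a.2 b b.2 (fun h => hab (Subtype.ext h)), biproduct.ι_π_ne _ hab]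
  · rw [biproduct.lift_desc]
    rw [← Finset.sum_coe_sort, Preadditive.comp_sum] at h₃
    simpa using h₃

theorem IsSplitSemisimple.finite_hom (hC : IsSplitSemisimple k C) (A B : C) :
    Module.Finite k (A ⟶ B) := by
  obtain ⟨d⟩ := hC.nonempty_simpleDecomposition A
  obtain ⟨d'⟩ := hC.nonempty_simpleDecomposition B
  have hfin : ∀ a b, Module.Finite k (d.S a ⟶ d'.S b) := by
    intro a b
    by_cases h : Nonempty (d.S a ≅ d'.S b)
    · obtain ⟨e⟩ := h
      refine ⟨⟨{e.hom}, ?_⟩⟩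
      rw [eq_top_iff]
      intro f _
      obtain ⟨c, hc⟩ := (isSplitSimple_iff.1 (d.simple a)).2 (f ≫ e.inv)
      simp only [Finset.coe_singleton, Submodule.mem_span_singleton]
      refine ⟨c, ?_⟩
      rw [← Category.id_comp e.hom, ← Linear.smul_comp, ← hc]
      simp
    · have hz := hC.hom_eq_zero _ _ (d.simple a) (d'.simple b) (not_nonempty_iff.1 h)
      have : Subsingleton (d.S a ⟶ d'.S b) := ⟨fun f g => by rw [hz f, hz g]⟩
      infer_instance
  let φ : (A ⟶ B) →ₗ[k] ∀ a b, d.S a ⟶ d'.S b :=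
    { toFun := fun f a b => d.ι a ≫ f ≫ d'.π b
      map_add' := fun f g => by ext; simp
      map_smul' := fun c f => by ext; simp }
  refine Module.Finite.of_injective φ fun f g hfg => ?_
  have key : ∀ f : A ⟶ B, f = ∑ a, ∑ b, d.π a ≫ φ f a b ≫ d'.ι b := by
    intro f
    calc f = (∑ a, d.π a ≫ d.ι a) ≫ f ≫ ∑ b, d'.π b ≫ d'.ι b := by
          rw [d.total, d'.total]; simp
      _ = _ := by
          rw [Finset.sum_comm]
          simp [φ, Preadditive.sum_comp, Preadditive.comp_sum]
  rw [key f, key g, hfg]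

/-- Nonzero morphisms between simple objects are isomorphisms as soon as all morphisms are von
Neumann regular. -/
theorem nonempty_iso_of_pseudoinverse
    (hreg : ∀ {A B : C} (f : A ⟶ B), ∃ g : B ⟶ A, f ≫ g ≫ f = f) {X Y : C} (hX : IsSplitSimple k X)
    (hY : IsSplitSimple k Y) {f : X ⟶ Y} (hf : f ≠ 0) : Nonempty (X ≅ Y) := by
  obtain ⟨g, hg⟩ := hreg f
  obtain ⟨c, hc⟩ := (isSplitSimple_iff.1 hX).2 (f ≫ g)
  obtain ⟨c', hc'⟩ := (isSplitSimple_iff.1 hY).2 (g ≫ f)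
  have h1 : c • f = f := by
    rw [← Category.assoc, hc, Linear.smul_comp, Category.id_comp] at hg
    exact hg
  have h2 : c' • f = f := by
    rw [hc', Linear.comp_smul, Category.comp_id] at hg
    exact hg
  have h3 : ∀ a : k, a • f = f → a = 1 := by
    intro a ha
    rw [← sub_eq_zero, ← one_smul k f, smul_smul, ← sub_smul, mul_one, smul_eq_zero] at ha
    exact sub_eq_zero.1 (ha.resolve_right hf)
  exact ⟨⟨f, g, by rw [hc, h3 c h1, one_smul], by rw [hc', h3 c' h2, one_smul]⟩⟩

/-- Subtracting a non-scalar endomorphism from one of its eigenvalues gives a nonzero non-unit `g`.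
With a pseudoinverse `h`, both `g ≫ h` and `h ≫ g` are nonzero idempotents, and they cannot both be
the identity. -/
theorem exists_idempotent_of_not_isSplitSimple [IsAlgClosed k]
    (hreg : ∀ {A B : C} (f : A ⟶ B), ∃ g : B ⟶ A, f ≫ g ≫ f = f)
    (hfin : ∀ A : C, Module.Finite k (A ⟶ A)) {A : C} (h0 : 𝟙 A ≠ 0)
    (hA : ¬ IsSplitSimple k A) : ∃ e : A ⟶ A, e ≫ e = e ∧ e ≠ 0 ∧ e ≠ 𝟙 A := by
  have hns : ∃ f : A ⟶ A, ∀ c : k, f ≠ c • 𝟙 A := by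
    by_contra! h
    exact hA (isSplitSimple_iff.2 ⟨h0, h⟩)
  obtain ⟨f, hf⟩ := hns
  have : Module.Finite k (End A) := hfin A
  have : Nontrivial (End A) := ⟨⟨𝟙 A, 0, h0⟩⟩
  obtain ⟨c, hc⟩ := spectrum.nonempty_of_isAlgClosed_of_finiteDimensional k (A := End A) f
  set g : A ⟶ A := c • 𝟙 A - f with hgdef
  have hg0 : g ≠ 0 := fun h => hf c (sub_eq_zero.1 h).symm
  have hgu : ¬ IsUnit (M := End A) g := hc
  obtain ⟨h, hh⟩ := hreg g
  by_cases h1 : g ≫ h = 𝟙 A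
  · refine ⟨h ≫ g, by simp [hh], fun h' => hg0 ?_, fun h' => hgu ?_⟩
    · rw [← hh, h', comp_zero]
    · exact ⟨⟨g, h, h', h1⟩, rfl⟩
  · refine ⟨g ≫ h, by rw [Category.assoc, reassoc_of% hh], fun h' => hg0 ?_, h1⟩
    rw [← hh, ← Category.assoc, h', zero_comp]

theorem nonempty_simpleDecomposition_of_pseudoinverse [IsAlgClosed k] [IsIdempotentComplete C]
    (hreg : ∀ {A B : C} (f : A ⟶ B), ∃ g : B ⟶ A, f ≫ g ≫ f = f)
    (hfin : ∀ A : C, Module.Finite k (A ⟶ A))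
    (A : C) : Nonempty (SimpleDecomposition k A) := by
  induction hn : Module.finrank k (A ⟶ A) using Nat.strong_induction_on generalizing A with
  | _ n ih =>
  by_cases h0 : 𝟙 A = 0
  · exact ⟨⟨Empty, Empty.elim, fun a => a.elim, fun a => a.elim, fun a => a.elim,
      fun a => a.elim, fun a => a.elim, by simp [h0]⟩⟩
  by_cases hA : IsSplitSimple k A
  · exact ⟨⟨Unit, fun _ => A, fun _ => hA, fun _ => 𝟙 A, fun _ => 𝟙 A, fun _ => by simp,
      fun a b h => (h rfl).elim, by simp⟩⟩
  obtain ⟨e, he, he0, he1⟩ := exists_idempotent_of_not_isSplitSimple hreg hfin h0 hA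
  have key : ∀ e : A ⟶ A, e ≫ e = e → e ≠ 𝟙 A → ∃ (Y : C) (i : Y ⟶ A) (p : A ⟶ Y),
      i ≫ p = 𝟙 Y ∧ p ≫ i = e ∧ Nonempty (SimpleDecomposition k Y) := by
    intro e he he1
    obtain ⟨Y, i, p, hip, hpi⟩ := IsIdempotentComplete.idempotents_split A e he
    -- The endomorphisms of `Y` embed into those of `A` by `f ↦ p ≫ f ≫ i`. The identity of `A` is
    -- not reached, since that would force `e = 𝟙 A`, so the dimension drops.
    refine ⟨Y, i, p, hip, hpi, ih _ ?_ Y rfl⟩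
    have := hfin A
    have := hfin Y
    let φ : (Y ⟶ Y) →ₗ[k] (A ⟶ A) :=
      { toFun := fun f => p ≫ f ≫ i
        map_add' := fun f g => by simp
        map_smul' := fun c f => by simp }
    have hφ : Function.Injective φ := by
      intro f g hfg
      have : ∀ f : Y ⟶ Y, f = i ≫ φ f ≫ p := fun f => by simp [φ, hip, reassoc_of% hip]
      rw [this f, this g, hfg]
    have hlt : LinearMap.range φ < ⊤ := by
      rw [lt_top_iff_ne_top]
      intro htop
      obtain ⟨f, hf⟩ : 𝟙 A ∈ LinearMap.range φ := htop ▸ Submodule.mem_top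
      have hf' : p ≫ f ≫ i = 𝟙 A := hf
      apply he1
      rw [← Category.comp_id e, ← hf', ← hpi]
      simp [reassoc_of% hip]
    rw [← hn, ← LinearMap.finrank_range_of_inj hφ]
    exact Submodule.finrank_lt hlt.ne
  obtain ⟨Y, i, p, hip, hpi, ⟨d⟩⟩ := key e he he1
  obtain ⟨Y', i', p', hip', hpi', ⟨d'⟩⟩ := key (𝟙 A - e) (by simp [he])
    (fun h => he0 (by simpa using h))
  refine ⟨d.sum d' i p i' p' hip hip' ?_ ?_ ?_⟩
  · have : i ≫ p' = (i ≫ p) ≫ i ≫ p' ≫ i' ≫ p' := by simp [hip, hip']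
    rw [this, reassoc_of% hpi', Category.assoc, reassoc_of% hpi]
    simp [reassoc_of% he]
  · have : i' ≫ p = (i' ≫ p') ≫ i' ≫ p ≫ i ≫ p := by simp [hip, hip']
    rw [this, reassoc_of% hpi, Category.assoc, reassoc_of% hpi']
    simp [reassoc_of% he]
  · rw [hpi, hpi']
    simp

/-- A linear category with finite direct sums, split idempotents, von Neumann regular morphisms
and finite-dimensional endomorphism algebras is split semisimple over an algebraically closed
field. -/
theorem isSplitSemisimple_of_pseudoinverse [IsAlgClosed k] [IsIdempotentComplete C]
    (hreg : ∀ {A B : C} (f : A ⟶ B), ∃ g : B ⟶ A, f ≫ g ≫ f = f)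
    (hfin : ∀ A : C, Module.Finite k (A ⟶ A))
    (hbi : HasFiniteBiproducts C) : IsSplitSemisimple k C where
  hasFiniteBiproducts := hbi
  exists_decomposition A :=
    (nonempty_simpleDecomposition_of_pseudoinverse hreg hfin A).some.exists_bicone
  hom_eq_zero X Y hX hY hXY f := by
    by_contra hf
    exact not_isEmpty_iff.2 (nonempty_iso_of_pseudoinverse hreg hX hY hf) hXY

end LinearCategory

section WhiskerSum

variable {C : Type u} [Category.{v} C] [Preadditive C] [MonoidalCategory C] [MonoidalPreadditive C]
  {J : Type*} [Fintype J] {O : J → C} {P : C} {π : ∀ a, P ⟶ O a} {ι : ∀ a, O a ⟶ P}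

theorem sum_whiskerLeft_comp (total : ∑ a, π a ≫ ι a = 𝟙 P) (X : C) :
    ∑ a, X ◁ π a ≫ X ◁ ι a = 𝟙 (X ⊗ P) := by
  simp_rw [← MonoidalCategory.whiskerLeft_comp]
  rw [← whiskerLeft_sum, total, whiskerLeft_id]

theorem sum_comp_whiskerRight (total : ∑ a, π a ≫ ι a = 𝟙 P) (X : C) :
    ∑ a, π a ▷ X ≫ ι a ▷ X = 𝟙 (P ⊗ X) := by
  simp_rw [← comp_whiskerRight]
  rw [← sum_whiskerRight, total, id_whiskerRight]

theorem hom_ext_whiskerLeft_comp (total : ∑ a, π a ≫ ι a = 𝟙 P) (X : C) {Y : C}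
    {f g : Y ⟶ X ⊗ P} (h : ∀ a, f ≫ X ◁ π a = g ≫ X ◁ π a) : f = g := by
  rw [← Category.comp_id f, ← Category.comp_id g, ← sum_whiskerLeft_comp total X,
    Preadditive.comp_sum, Preadditive.comp_sum]
  refine Finset.sum_congr rfl fun a _ => ?_
  rw [← Category.assoc, h a, Category.assoc]

end WhiskerSum

/-! ### Direct sums and split idempotents in the relative center. -/

namespace RelativeCenter

variable {k : Type w} [CommRing k] {C : Type u} [Category.{v} C] [Preadditive C] [Linear k C]
  [MonoidalCategory C] [PivotalCategory C] {D : LinearPivotalSubcategory k C}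

theorem hom_ext {A B : RelativeCenter D} {f g : A ⟶ B} (h : f.f = g.f) : f = g := Hom.ext h

variable [MonoidalPreadditive C] [MonoidalLinear k C]

variable (k) in
/-- The inclusion of the morphisms of half braidings into the morphisms of `C`. -/
def forgetₗ (A B : RelativeCenter D) : (A ⟶ B) →ₗ[k] (A.obj ⟶ B.obj) where
  toFun f := f.f
  map_add' _ _ := rfl
  map_smul' _ _ := rfl

theorem sum_f {J : Type*} (s : Finset J) {A B : RelativeCenter D} (f : J → (A ⟶ B)) :
    Hom.f (∑ a ∈ s, f a : A ⟶ B) = ∑ a ∈ s, (f a).f :=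
  map_sum (forgetₗ k A B) f s

section Glue

variable {J : Type} [Fintype J] (A : J → RelativeCenter D) {P : C} (π : ∀ a, P ⟶ (A a).obj)
  (ι : ∀ a, (A a).obj ⟶ P)

/-- The morphism `P ⊗ X ⟶ X ⊗ P` assembled from half braidings. -/
noncomputable def glueHom (X : D.Obj) : P ⊗ X.val ⟶ X.val ⊗ P :=
  ∑ a, π a ▷ X.val ≫ ((A a).σ X).hom ≫ X.val ◁ ι a

/-- The inverse of `glueHom`. -/
noncomputable def glueInv (X : D.Obj) : X.val ⊗ P ⟶ P ⊗ X.val :=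
  ∑ a, X.val ◁ π a ≫ ((A a).σ X).inv ≫ ι a ▷ X.val

variable {A π ι}

/-- Each `ι a ≫ π b` slides through the half braidings, after which `total` collapses the sum.
Orthogonality of the `ι a` and `π b` plays no role, so the same gluing serves direct sums and images
of idempotents. -/
theorem glueHom_comp (total : ∑ a, π a ≫ ι a = 𝟙 P)
    (hm : ∀ a b, ι a ≫ π b ∈ homSubmodule (A a) (A b)) (X : D.Obj) (b : J) :
    glueHom A π ι X ≫ X.val ◁ π b = π b ▷ X.val ≫ ((A b).σ X).hom := by
  rw [glueHom, Preadditive.sum_comp]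
  have : ∀ a, (π a ▷ X.val ≫ ((A a).σ X).hom ≫ X.val ◁ ι a) ≫ X.val ◁ π b =
      (π a ▷ X.val ≫ ι a ▷ X.val) ≫ π b ▷ X.val ≫ ((A b).σ X).hom := by
    intro a
    have := hm a b X
    simp only [MonoidalCategory.whiskerLeft_comp, comp_whiskerRight, Category.assoc] at this
    simp [this]
  simp_rw [this]
  rw [← Preadditive.sum_comp, sum_comp_whiskerRight total, Category.id_comp]

theorem comp_glueHom (total : ∑ a, π a ≫ ι a = 𝟙 P)
    (hm : ∀ a b, ι a ≫ π b ∈ homSubmodule (A a) (A b)) (X : D.Obj) (b : J) :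
    ι b ▷ X.val ≫ glueHom A π ι X = ((A b).σ X).hom ≫ X.val ◁ ι b := by
  rw [glueHom, Preadditive.comp_sum]
  have : ∀ a, ι b ▷ X.val ≫ π a ▷ X.val ≫ ((A a).σ X).hom ≫ X.val ◁ ι a =
      (((A b).σ X).hom ≫ X.val ◁ ι b) ≫ X.val ◁ π a ≫ X.val ◁ ι a := by
    intro a
    have := hm b a X
    simp only [MonoidalCategory.whiskerLeft_comp, comp_whiskerRight, Category.assoc] at this
    simp [reassoc_of% this]
  simp_rw [this]
  rw [← Preadditive.comp_sum, sum_whiskerLeft_comp total, Category.comp_id]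

/-- The half braiding on an object which is covered by half braidings in a compatible way. -/
noncomputable def glue (total : ∑ a, π a ≫ ι a = 𝟙 P)
    (hm : ∀ a b, ι a ≫ π b ∈ homSubmodule (A a) (A b)) : RelativeCenter D where
  obj := P
  σ X :=
    { hom := glueHom A π ι X
      inv := glueInv A π ι X
      hom_inv_id := by
        rw [glueInv, Preadditive.comp_sum, ← sum_comp_whiskerRight total]
        refine Finset.sum_congr rfl fun b _ => ?_
        rw [← Category.assoc, glueHom_comp total hm]
        simp
      inv_hom_id := by
        rw [glueInv, Preadditive.sum_comp, ← sum_whiskerLeft_comp total]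
        refine Finset.sum_congr rfl fun b _ => ?_
        rw [Category.assoc, Category.assoc, comp_glueHom total hm]
        simp }
  naturality {X Y} f := by
    change P ◁ f.1 ≫ glueHom A π ι Y = glueHom A π ι X ≫ f.1 ▷ P
    rw [glueHom, glueHom, Preadditive.comp_sum, Preadditive.sum_comp]
    refine Finset.sum_congr rfl fun a _ => ?_
    rw [whisker_exchange_assoc, reassoc_of% ((A a).naturality f)]
    simp [whisker_exchange]
  monoidal X Y := by
    change glueHom A π ι (X ⊗ Y) = (α_ P X.val Y.val).inv ≫ glueHom A π ι X ▷ Y.val ≫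
      (α_ X.val P Y.val).hom ≫ X.val ◁ glueHom A π ι Y ≫ (α_ X.val Y.val P).inv
    refine hom_ext_whiskerLeft_comp total (X.val ⊗ Y.val) fun b => ?_
    refine (glueHom_comp total hm (X ⊗ Y) b).trans ?_
    rw [(A b).monoidal]
    change π b ▷ (X.val ⊗ Y.val) ≫ _ = _
    have hY := glueHom_comp total hm Y b
    have hX := glueHom_comp total hm X b
    simp only [Category.assoc, MonoidalCategory.tensor_whiskerLeft, Iso.inv_hom_id_assoc]
    rw [← MonoidalCategory.whiskerLeft_comp_assoc, hY]
    simp only [MonoidalCategory.whiskerLeft_comp, Category.assoc]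
    rw [← associator_naturality_middle_assoc, ← comp_whiskerRight_assoc, hX,
      associator_inv_naturality_left_assoc]
    simp only [comp_whiskerRight, Category.assoc]

variable (total : ∑ a, π a ≫ ι a = 𝟙 P) (hm : ∀ a b, ι a ≫ π b ∈ homSubmodule (A a) (A b))

/-- The projections of `glue`. -/
noncomputable def glueπ (a : J) : glue total hm ⟶ A a := ⟨π a, fun X => glueHom_comp total hm X a⟩

/-- The inclusions of `glue`. -/
noncomputable def glueι (a : J) : A a ⟶ glue total hm :=
  ⟨ι a, fun X => (comp_glueHom total hm X a).symm⟩

end Glue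

instance isIdempotentComplete [IsIdempotentComplete C] :
    IsIdempotentComplete (RelativeCenter D) where
  idempotents_split A e he := by
    obtain ⟨Y, i, p, hip, hpi⟩ := IsIdempotentComplete.idempotents_split A.obj e.f
      (congrArg Hom.f he)
    -- Gluing along a single index: `i` acts as the projection from `Y` and `p` as the inclusion
    -- into it, so the transition morphism `p ≫ i` is `e.f`.
    have total : ∑ _a : Unit, i ≫ p = 𝟙 Y := by simp [hip]
    have hm : ∀ _a _b : Unit, p ≫ i ∈ homSubmodule A A := fun _ _ => by
      rw [hpi]
      exact e.comm
    exact ⟨glue (A := fun _ : Unit => A) total hm, glueπ (A := fun _ : Unit => A) total hm (),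
      glueι (A := fun _ : Unit => A) total hm (), hom_ext hip, hom_ext hpi⟩

theorem hasFiniteBiproducts [HasFiniteBiproducts C] :
    HasFiniteBiproducts (RelativeCenter D) where
  out n := ⟨fun F => by
    have total : ∑ a, biproduct.π (fun a => (F a).obj) a ≫ biproduct.ι (fun a => (F a).obj) a =
        𝟙 _ := biproduct.total
    have hid : ∀ a, 𝟙 (F a).obj ∈ homSubmodule (F a) (F a) := fun a => Hom.comm (𝟙 (F a))
    have hm : ∀ a b, biproduct.ι (fun a => (F a).obj) a ≫ biproduct.π (fun a => (F a).obj) b ∈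
        homSubmodule (F a) (F b) := by
      intro a b
      by_cases h : a = b
      · subst h
        rw [biproduct.ι_π_self]
        exact hid a
      · rw [biproduct.ι_π_ne _ h]
        exact zero_mem _
    let b : Bicone F :=
      { pt := glue total hm
        π := glueπ total hm
        ι := glueι total hm
        ι_π := fun a b => by
          split_ifs with h
          · subst h
            exact hom_ext (biproduct.ι_π_self _ a)
          · exact hom_ext (biproduct.ι_π_ne _ h) }
    exact hasBiproduct_of_total b (hom_ext ((sum_f _ _).trans total))⟩

end RelativeCenter

/-! ### Bending strands and the comparison of the two contractions. -/

namespace PivotalCategory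

/-- Uniqueness of duals: `X` is dual to `dual X` on the same side as `dual Y` is to `Y`, because
`dual X` is a two-sided dual. -/
theorem nonempty_iso_dual {C : Type u} [Category.{v} C] [MonoidalCategory C]
    [PivotalCategory C] {X Y : C} (e : dual X ≅ Y) : Nonempty (X ≅ dual Y) :=
  ⟨rightDualIso (@exactPairingCongrLeft _ _ _ _ _ _ (rightPairing X) e.symm) (leftPairing Y)⟩

section Bend

variable (k : Type w) [CommRing k] {C : Type u} [Category.{v} C] [Preadditive C] [Linear k C]
  [MonoidalCategory C] [MonoidalPreadditive C] [MonoidalLinear k C] [PivotalCategory C]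

/-- Bending the right input strand upwards. -/
def bendInRight (X i j : C) : (X ⊗ i ⟶ j) ≃ₗ[k] (X ⟶ j ⊗ dual i) where
  __ := @tensorRightHomEquiv C _ _ X i (dual i) j (leftPairing i)
  map_add' f g := by simp [tensorRightHomEquiv]
  map_smul' c f := by simp [tensorRightHomEquiv]

/-- Bending the right output strand downwards. -/
def bendOutRight (X i j : C) : (j ⟶ X ⊗ i) ≃ₗ[k] (j ⊗ dual i ⟶ X) where
  __ := (@tensorRightHomEquiv C _ _ j (dual i) i X (rightPairing i)).symm
  map_add' f g := by simp [tensorRightHomEquiv]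
  map_smul' c f := by simp [tensorRightHomEquiv]

/-- Bending the left input strand upwards. -/
def bendInLeft (X j Z : C) : (dual j ⊗ X ⟶ Z) ≃ₗ[k] (X ⟶ j ⊗ Z) where
  __ := @tensorLeftHomEquiv C _ _ X j (dual j) Z (leftPairing j)
  map_add' f g := by simp [tensorLeftHomEquiv]
  map_smul' c f := by simp [tensorLeftHomEquiv]

/-- Bending the left output strand downwards. -/
def bendOutLeft (X j Z : C) : (Z ⟶ dual j ⊗ X) ≃ₗ[k] (j ⊗ Z ⟶ X) where
  __ := (@tensorLeftHomEquiv C _ _ Z (dual j) j X (rightPairing j)).symm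
  map_add' f g := by simp [tensorLeftHomEquiv]
  map_smul' c f := by simp [tensorLeftHomEquiv]

variable {k}

theorem bendInRight_apply {X i j : C} (p : X ⊗ i ⟶ j) :
    bendInRight k X i j p = (ρ_ X).inv ≫ X ◁ coev i ≫ (α_ X i (dual i)).inv ≫ p ▷ dual i := rfl

theorem bendInRight_symm_apply {X i j : C} (x : X ⟶ j ⊗ dual i) :
    (bendInRight k X i j).symm x = x ▷ i ≫ (α_ j (dual i) i).hom ≫ j ◁ ev i ≫ (ρ_ j).hom := rfl

theorem bendOutRight_apply {X i j : C} (q : j ⟶ X ⊗ i) :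
    bendOutRight k X i j q =
      q ▷ dual i ≫ (α_ X i (dual i)).hom ≫ X ◁ evR i ≫ (ρ_ X).hom := rfl

theorem bendOutRight_symm_apply {X i j : C} (y : j ⊗ dual i ⟶ X) :
    (bendOutRight k X i j).symm y =
      (ρ_ j).inv ≫ j ◁ coevR i ≫ (α_ j (dual i) i).inv ≫ y ▷ i := rfl

theorem bendInLeft_apply {X j Z : C} (u : dual j ⊗ X ⟶ Z) :
    bendInLeft k X j Z u = (λ_ X).inv ≫ coev j ▷ X ≫ (α_ j (dual j) X).hom ≫ j ◁ u := rfl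

theorem bendInLeft_symm_apply {X j Z : C} (x : X ⟶ j ⊗ Z) :
    (bendInLeft k X j Z).symm x =
      dual j ◁ x ≫ (α_ (dual j) j Z).inv ≫ ev j ▷ Z ≫ (λ_ Z).hom := rfl

theorem bendOutLeft_apply {X j Z : C} (v : Z ⟶ dual j ⊗ X) :
    bendOutLeft k X j Z v = j ◁ v ≫ (α_ j (dual j) X).inv ≫ evR j ▷ X ≫ (λ_ X).hom := rfl

theorem bendOutLeft_symm_apply {X j Z : C} (y : j ⊗ Z ⟶ X) :
    (bendOutLeft k X j Z).symm y =
      (λ_ Z).inv ≫ coevR j ▷ Z ≫ (α_ (dual j) j Z).hom ≫ dual j ◁ y := rfl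

/-- The two ways of closing the strands of an endomorphism of `j ⊗ dual i` agree. -/
theorem trL_bendRight_eq {X i j : C} (x : X ⟶ j ⊗ dual i) (y : j ⊗ dual i ⟶ X) :
    trL ((bendOutRight k X i j).symm y ≫ (bendInRight k X i j).symm x) =
      coevR i ≫ ((bendOutLeft k X j (dual i)).symm y ≫
        (bendInLeft k X j (dual i)).symm x) ▷ i ≫ ev i := by
  rw [trL, bendOutRight_symm_apply, bendInRight_symm_apply, bendOutLeft_symm_apply,
    bendInLeft_symm_apply]
  -- Both sides are the diagram of `y` then `x` with the strand `j` closed on the left and `dual i`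
  -- closed on the right. They differ only in the heights of disjoint cups and caps, which the
  -- interchange law swaps.
  calc _ = 𝟙 _ ⊗≫ (coevR j ▷ 𝟙_ C ≫ (dual j ⊗ j) ◁ coevR i) ⊗≫ dual j ◁ y ▷ i ⊗≫
          dual j ◁ x ▷ i ⊗≫ ((dual j ⊗ j) ◁ ev i ≫ ev j ▷ 𝟙_ C) ⊗≫ 𝟙 _ := by monoidal
    _ = 𝟙 _ ⊗≫ (𝟙_ C ◁ coevR i ≫ coevR j ▷ (dual i ⊗ i)) ⊗≫ dual j ◁ y ▷ i ⊗≫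
          dual j ◁ x ▷ i ⊗≫ (ev j ▷ (dual i ⊗ i) ≫ 𝟙_ C ◁ ev i) ⊗≫ 𝟙 _ := by
        rw [whisker_exchange, whisker_exchange]
    _ = _ := by monoidal

/-- Contraction with the pairing on the right strand and with the pairing on the left strand
give the same tensor up to left dimensions. -/
theorem smul_sum_bend_eq {M : Type*} [AddCommGroup M] [Module k M] {X i j : C}
    (hone : ∀ c : k, c • 𝟙 (𝟙_ C) = 0 → c = 0)
    (hj : ∀ e : j ⟶ j, ∃ c : k, e = c • 𝟙 j)
    (hi : ∀ e : dual i ⟶ dual i, ∃ c : k, e = c • 𝟙 (dual i))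
    {δi δj : k} (hδi : dimL i = δi • 𝟙 (𝟙_ C)) (hδj : dimL j = δj • 𝟙 (𝟙_ C))
    {K L : Type*} [Fintype K] [Fintype L]
    (p : K → (X ⊗ i ⟶ j)) (q : K → (j ⟶ X ⊗ i))
    (hpq : ∀ y : j ⟶ X ⊗ i, ∑ a, (y ≫ p a) ≫ q a = y)
    (u : L → (dual j ⊗ X ⟶ dual i)) (v : L → (dual i ⟶ dual j ⊗ X))
    (huv : ∀ x : dual j ⊗ X ⟶ dual i, ∑ b, u b ≫ v b ≫ x = x)
    (Ψ : (X ⟶ j ⊗ dual i) →ₗ[k] (j ⊗ dual i ⟶ X) →ₗ[k] M) :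
    δi • ∑ a, Ψ (bendInRight k X i j (p a)) (bendOutRight k X i j (q a)) =
      δj • ∑ b, Ψ (bendInLeft k X j (dual i) (u b)) (bendOutLeft k X j (dual i) (v b)) := by
  choose cj hcj using hj
  choose ci hci using hi
  let P a := bendInRight k X i j (p a)
  let Q a := bendOutRight k X i j (q a)
  let U b := bendInLeft k X j (dual i) (u b)
  let V b := bendOutLeft k X j (dual i) (v b)
  let c₁ a b := cj ((bendOutRight k X i j).symm (V b) ≫ p a)
  let c₂ a b := ci (v b ≫ (bendInLeft k X j (dual i)).symm (P a))
  -- By simplicity of `j` and `dual i`, `c₁` and `c₂` are scalars expanding `V` in `Q` and `P` in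
  -- `U`. The trace identity relates them by `δi * c₂ = δj * c₁`, and both sides of the claim become
  -- the same double sum over `Ψ (U b) (Q a)`.
  have hP : ∀ a, P a = ∑ b, c₂ a b • U b := by
    intro a
    apply (bendInLeft k X j (dual i)).symm.injective
    rw [← huv ((bendInLeft k X j (dual i)).symm (P a)), map_sum]
    refine Finset.sum_congr rfl fun b _ => ?_
    rw [hci (v b ≫ _), map_smul, Linear.comp_smul, Category.comp_id, LinearEquiv.symm_apply_apply]
  have hV : ∀ b, V b = ∑ a, c₁ a b • Q a := by
    intro b
    apply (bendOutRight k X i j).symm.injective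
    rw [← hpq ((bendOutRight k X i j).symm (V b)), map_sum]
    refine Finset.sum_congr rfl fun a _ => ?_
    rw [hcj (_ ≫ p a), map_smul, Linear.smul_comp, Category.id_comp, LinearEquiv.symm_apply_apply]
  have hc : ∀ a b, δi * c₂ a b = δj * c₁ a b := by
    intro a b
    have h := trL_bendRight_eq (k := k) (P a) (V b)
    have hp : (bendInRight k X i j).symm (P a) = p a := LinearEquiv.symm_apply_apply _ _
    have hv : (bendOutLeft k X j (dual i)).symm (V b) = v b := LinearEquiv.symm_apply_apply _ _
    rw [hp, hv, hcj (_ ≫ p a), hci (v b ≫ _)] at h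
    have h₁ : trL (c₁ a b • 𝟙 j) = (c₁ a b * δj) • 𝟙 (𝟙_ C) := by
      rw [mul_smul, ← hδj]
      simp [trL, dimL]
    have h₂ : coevR i ≫ (c₂ a b • 𝟙 (dual i)) ▷ i ≫ ev i = (c₂ a b * δi) • 𝟙 (𝟙_ C) := by
      rw [mul_smul, ← hδi]
      simp [trL, dimL]
    have h' : (c₁ a b * δj) • 𝟙 (𝟙_ C) = (c₂ a b * δi) • 𝟙 (𝟙_ C) := h₁.symm.trans (h.trans h₂)
    have := hone (c₁ a b * δj - c₂ a b * δi) (by rw [sub_smul, h', sub_self])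
    linear_combination -this
  change δi • ∑ a, Ψ (P a) (Q a) = δj • ∑ b, Ψ (U b) (V b)
  simp_rw [hP, hV]
  simp only [map_sum, map_smul, LinearMap.sum_apply, LinearMap.smul_apply, Finset.smul_sum,
    smul_smul, hc]
  exact Finset.sum_comm

variable (k) in
/-- Duality as an isomorphism of modules of morphisms. -/
def dualHomEquiv (X Y : C) : (dual X ⟶ dual Y) ≃ₗ[k] (Y ⟶ X) :=
  (Linear.homCongr k (λ_ (dual X)).symm (Iso.refl (dual Y))).trans <|
    (bendOutRight k (dual Y) X (𝟙_ C)).symm.trans <|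
      (bendOutLeft k X Y (𝟙_ C)).trans <| Linear.homCongr k (ρ_ Y) (Iso.refl X)

end Bend

end PivotalCategory

/-! ### Representative families of simple objects and their duals. -/

section CompleteFamily

variable {k : Type w} [Field k] {C : Type u} [Category.{v} C] [Preadditive C] [Linear k C]

variable (k) in
/-- A family of simple objects that represents every isomorphism class of simple objects exactly
once. -/
structure IsCompleteSimpleFamily {I : Type*} (T : I → C) : Prop where
  simple : ∀ c, IsSplitSimple k (T c)
  hom_eq_zero : ∀ c c', c ≠ c' → ∀ f : T c ⟶ T c', f = 0
  exists_iso : ∀ S : C, IsSplitSimple k S → ∃ c, Nonempty (S ≅ T c)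

theorem isCompleteSimpleFamily_out (hC : IsSplitSemisimple k C) :
    IsCompleteSimpleFamily k fun c : SimpleClasses k C => c.1.out where
  simple c := c.2
  hom_eq_zero c c' h := by
    refine hC.hom_eq_zero _ _ c.2 c'.2 ⟨fun e => h (Subtype.ext ?_)⟩
    rw [← c.1.out_eq, ← c'.1.out_eq]
    exact Quotient.sound ⟨e⟩
  exists_iso S hS := by
    have e : Nonempty ((Quotient.mk (isIsomorphicSetoid C) S).out ≅ S) :=
      Quotient.exact (Quotient.out_eq (Quotient.mk (isIsomorphicSetoid C) S))
    exact ⟨⟨Quotient.mk (isIsomorphicSetoid C) S, hS.of_iso e.some.symm⟩, ⟨e.some.symm⟩⟩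

-- Needed because bending `i` to the other side turns decompositions along `T` into decompositions
-- along the duals of `T`.
open PivotalCategory in
theorem IsCompleteSimpleFamily.dual [MonoidalCategory C] [MonoidalPreadditive C]
    [MonoidalLinear k C] [PivotalCategory C] {I : Type*} {T : I → C}
    (hT : IsCompleteSimpleFamily k T) : IsCompleteSimpleFamily k fun c => dual (T c) := by
  have hs : ∀ S : C, IsSplitSimple k S → IsSplitSimple k (PivotalCategory.dual S) := fun S hS =>
    ⟨inferInstance, (dualHomEquiv k S S).rank_eq.trans hS.2⟩
  refine ⟨fun c => hs _ (hT.simple c), fun c c' h f => ?_, fun S hS => ?_⟩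
  · apply (dualHomEquiv k _ _).injective
    rw [hT.hom_eq_zero _ _ h.symm (dualHomEquiv k _ _ f), map_zero]
  · obtain ⟨c, ⟨e⟩⟩ := hT.exists_iso _ (hs S hS)
    exact ⟨c, nonempty_iso_dual e⟩

/-- A resolution of the identity of `Y` by morphisms through a family of simple objects. -/
structure FamilyResolution {I : Type*} [Fintype I] (T : I → C) (Y : C) where
  /-- the multiplicity spaces -/
  K : I → Type
  [fintype : ∀ c, Fintype (K c)]
  /-- the projections -/
  p : ∀ c, K c → (Y ⟶ T c)
  /-- the inclusions -/
  q : ∀ c, K c → (T c ⟶ Y)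
  total : ∑ c, ∑ a, p c a ≫ q c a = 𝟙 Y

attribute [instance] FamilyResolution.fintype

theorem IsCompleteSimpleFamily.nonempty_resolution (hC : IsSplitSemisimple k C) {I : Type*}
    [Fintype I] {T : I → C} (hT : IsCompleteSimpleFamily k T) (Y : C) :
    Nonempty (FamilyResolution T Y) := by
  classical
  obtain ⟨d⟩ := hC.nonempty_simpleDecomposition Y
  choose cl e using fun a => hT.exists_iso (d.S a) (d.simple a)
  have e' : ∀ c, ∀ a : {a // cl a = c}, Nonempty (d.S a ≅ T c) := by
    rintro c ⟨a, rfl⟩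
    exact e a
  refine ⟨⟨fun c => {a // cl a = c}, fun c a => d.π a ≫ (e' c a).some.hom,
    fun c a => (e' c a).some.inv ≫ d.ι a, ?_⟩⟩
  simp only [Category.assoc, Iso.hom_inv_id_assoc]
  exact (Fintype.sum_fiberwise cl fun a => d.π a ≫ d.ι a).trans d.total

/-- Summands at indices other than `c` are killed by vanishing of morphisms between distinct
simples. This one-sided identity and its mirror image replace dual bases in `smul_sum_bend_eq`. -/
theorem IsCompleteSimpleFamily.sum_comp_resolution {I : Type*} [Fintype I] {T : I → C}
    (hT : IsCompleteSimpleFamily k T) {Y : C} (r : FamilyResolution T Y) {c : I} (y : T c ⟶ Y) :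
    ∑ a, (y ≫ r.p c a) ≫ r.q c a = y := by
  conv_rhs => rw [← Category.comp_id y, ← r.total, Preadditive.comp_sum]
  rw [Finset.sum_eq_single c]
  · simp [Preadditive.comp_sum]
  · intro c' _ h
    rw [Preadditive.comp_sum]
    refine Finset.sum_eq_zero fun a _ => ?_
    rw [← Category.assoc, hT.hom_eq_zero c c' h.symm (y ≫ _), zero_comp]
  · simp

theorem IsCompleteSimpleFamily.sum_resolution_comp {I : Type*} [Fintype I] {T : I → C}
    (hT : IsCompleteSimpleFamily k T) {Y : C} (r : FamilyResolution T Y) {c : I} (x : Y ⟶ T c) :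
    ∑ a, r.p c a ≫ r.q c a ≫ x = x := by
  conv_rhs => rw [← Category.id_comp x, ← r.total, Preadditive.sum_comp]
  rw [Finset.sum_eq_single c]
  · simp [Preadditive.sum_comp]
  · intro c' _ h
    rw [Preadditive.sum_comp]
    refine Finset.sum_eq_zero fun a _ => ?_
    rw [Category.assoc, hT.hom_eq_zero c' c h (_ ≫ x), comp_zero]
  · simp

end CompleteFamily

/-! ### Sandwiched morphisms and partial traces. -/

section Sandwich

variable {C : Type u} [Category.{v} C] [MonoidalCategory C]

/-- A morphism `A ⊗ j ⟶ B ⊗ j` sandwiched between morphisms `X ⟶ j ⊗ Z` and `j ⊗ Z ⟶ X`. -/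
def sandwich {A B j X Z : C} (g : A ⊗ j ⟶ B ⊗ j) (x : X ⟶ j ⊗ Z) (y : j ⊗ Z ⟶ X) :
    A ⊗ X ⟶ B ⊗ X :=
  A ◁ x ≫ (α_ A j Z).inv ≫ g ▷ Z ≫ (α_ B j Z).hom ≫ B ◁ y

/-- The strand `Z` runs beside `g`, so `u` slides along it past `g`. -/
theorem sandwich_slide {A B j X Z Z' : C} (g : A ⊗ j ⟶ B ⊗ j) (x : X ⟶ j ⊗ Z) (u : Z ⟶ Z')
    (y : j ⊗ Z' ⟶ X) : sandwich g (x ≫ j ◁ u) y = sandwich g x (j ◁ u ≫ y) := by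
  simp only [sandwich, MonoidalCategory.whiskerLeft_comp, Category.assoc]
  rw [associator_inv_naturality_right_assoc, whisker_exchange_assoc,
    associator_naturality_right_assoc]

end Sandwich

namespace PivotalCategory

section PartialTrace

variable {k : Type w} [CommRing k] {C : Type u} [Category.{v} C] [MonoidalCategory C]
  [PivotalCategory C]

/-- The right partial trace over `Y`. -/
def ptrR {A B : C} (Y : C) (g : A ⊗ Y ⟶ B ⊗ Y) : A ⟶ B :=
  (ρ_ A).inv ≫ A ◁ coev Y ≫ (α_ A Y (dual Y)).inv ≫ g ▷ dual Y ≫ (α_ B Y (dual Y)).hom ≫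
    B ◁ evR Y ≫ (ρ_ B).hom

/-- The right partial trace over the second factor of `X ⊗ Y`. -/
def ptrRTensor {A B : C} (X Y : C) (g : A ⊗ X ⊗ Y ⟶ B ⊗ X ⊗ Y) : A ⊗ X ⟶ B ⊗ X :=
  ptrR Y ((α_ A X Y).hom ≫ g ≫ (α_ B X Y).inv)

theorem ptrR_whiskerRight_comp {A A' B Y : C} (f : A' ⟶ A) (g : A ⊗ Y ⟶ B ⊗ Y) :
    ptrR Y (f ▷ Y ≫ g) = f ≫ ptrR Y g := by
  simp only [ptrR, comp_whiskerRight, Category.assoc]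
  rw [← associator_inv_naturality_left_assoc, whisker_exchange_assoc,
    ← rightUnitor_inv_naturality_assoc]

theorem ptrR_comp_whiskerRight {A B B' Y : C} (g : A ⊗ Y ⟶ B ⊗ Y) (f : B ⟶ B') :
    ptrR Y (g ≫ f ▷ Y) = ptrR Y g ≫ f := by
  simp only [ptrR, comp_whiskerRight, Category.assoc]
  rw [associator_naturality_left_assoc, ← whisker_exchange_assoc, rightUnitor_naturality]

/-- Conjugating a partial trace by morphisms `A ⊗ X ⟶ X ⊗ A` and `X ⊗ B ⟶ B ⊗ X`. -/
theorem conj_ptrR {A B X Y : C} (s : A ⊗ X ⟶ X ⊗ A) (g : A ⊗ Y ⟶ B ⊗ Y) (t : X ⊗ B ⟶ B ⊗ X) :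
    s ≫ X ◁ ptrR Y g ≫ t =
      ptrRTensor X Y ((α_ A X Y).inv ≫ s ▷ Y ≫ (α_ X A Y).hom ≫ X ◁ g ≫ (α_ X B Y).inv ≫
        t ▷ Y ≫ (α_ B X Y).hom) := by
  have h : (α_ A X Y).hom ≫ ((α_ A X Y).inv ≫ s ▷ Y ≫ (α_ X A Y).hom ≫ X ◁ g ≫
      (α_ X B Y).inv ≫ t ▷ Y ≫ (α_ B X Y).hom) ≫ (α_ B X Y).inv =
      s ▷ Y ≫ ((α_ X A Y).hom ≫ X ◁ g ≫ (α_ X B Y).inv) ≫ t ▷ Y := by simp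
  rw [ptrRTensor, h, ptrR_whiskerRight_comp, ptrR_comp_whiskerRight]
  simp only [ptrR]
  monoidal

variable [Preadditive C] [Linear k C] [MonoidalPreadditive C] [MonoidalLinear k C]

theorem ptrRTensor_conj {A B X i j : C} (p : X ⊗ i ⟶ j) (g : A ⊗ j ⟶ B ⊗ j) (q : j ⟶ X ⊗ i) :
    ptrRTensor X i (A ◁ p ≫ g ≫ B ◁ q) =
      sandwich g (bendInRight k X i j p) (bendOutRight k X i j q) := by
  rw [bendInRight_apply, bendOutRight_apply]
  simp only [ptrRTensor, ptrR, sandwich]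
  monoidal

/-- The closing strand `dual j` and the strand `X` are read together as one strand `dual j ⊗ X`,
which can then be cut by a resolution of its identity. -/
theorem ptrR_whiskerRight {A B X j : C} (g : A ⊗ j ⟶ B ⊗ j) :
    ptrR j g ▷ X = sandwich g (bendInLeft k X j _ (𝟙 _)) (bendOutLeft k X j _ (𝟙 _)) := by
  rw [bendInLeft_apply, bendOutLeft_apply]
  simp only [ptrR, sandwich]
  monoidal

theorem sandwich_bendLeft {A B X Z j : C} (g : A ⊗ j ⟶ B ⊗ j) (u : dual j ⊗ X ⟶ Z)
    (v : Z ⟶ dual j ⊗ X) : sandwich g (bendInLeft k X j Z u) (bendOutLeft k X j Z v) =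
      sandwich g (bendInLeft k X j _ (𝟙 _)) (bendOutLeft k X j _ (u ≫ v)) := by
  have hu : bendInLeft k X j Z u = bendInLeft k X j _ (𝟙 _) ≫ j ◁ u := by
    simp [bendInLeft_apply]
  have hv : bendOutLeft k X j _ (u ≫ v) = j ◁ u ≫ bendOutLeft k X j Z v := by
    simp [bendOutLeft_apply]
  rw [hu, hv, sandwich_slide]

variable (k) in
/-- The partial trace over the second factor as a linear map. -/
def ptrRTensorₗ (A B X Y : C) : (A ⊗ X ⊗ Y ⟶ B ⊗ X ⊗ Y) →ₗ[k] (A ⊗ X ⟶ B ⊗ X) where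
  toFun := ptrRTensor X Y
  map_add' f g := by simp [ptrRTensor, ptrR]
  map_smul' c f := by simp [ptrRTensor, ptrR]

variable (k) in
/-- `sandwich` as a bilinear map. -/
def sandwichₗ {A B j : C} (X Z : C) (g : A ⊗ j ⟶ B ⊗ j) :
    (X ⟶ j ⊗ Z) →ₗ[k] (j ⊗ Z ⟶ X) →ₗ[k] (A ⊗ X ⟶ B ⊗ X) :=
  LinearMap.mk₂ k (sandwich g) (by simp [sandwich]) (by simp [sandwich]) (by simp [sandwich])
    (by simp [sandwich])

theorem ptrR_whiskerRight_eq_smul {A B Y : C} (f : A ⟶ B) {c : k}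
    (hc : dimR Y = c • 𝟙 (𝟙_ C)) : ptrR Y (f ▷ Y) = c • f := by
  have h : coev Y ≫ evR Y = c • 𝟙 (𝟙_ C) := by
    rw [← hc]
    simp [dimR, trR]
  have h1 : ptrR Y (𝟙 (A ⊗ Y)) = c • 𝟙 A := by
    simp [ptrR, ← MonoidalCategory.whiskerLeft_comp_assoc, h]
  rw [← Category.comp_id (f ▷ Y), ← id_whiskerRight, ← comp_whiskerRight, Category.comp_id,
    ← Category.id_comp (f ▷ Y), ptrR_comp_whiskerRight, h1]
  simp

end PartialTrace

end PivotalCategory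

namespace LinearPivotalSubcategory

variable {k : Type w} [CommRing k] {C : Type u} [Category.{v} C] [Preadditive C] [Linear k C]
  [MonoidalCategory C] [PivotalCategory C] (D : LinearPivotalSubcategory k C)

instance [MonoidalPreadditive C] : MonoidalPreadditive D.Obj where
  whiskerLeft_zero := Subtype.ext MonoidalPreadditive.whiskerLeft_zero
  zero_whiskerRight := Subtype.ext MonoidalPreadditive.zero_whiskerRight
  whiskerLeft_add f g := Subtype.ext (MonoidalPreadditive.whiskerLeft_add f.1 g.1)
  add_whiskerRight f g := Subtype.ext (MonoidalPreadditive.add_whiskerRight f.1 g.1)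

instance [MonoidalPreadditive C] [MonoidalLinear k C] : MonoidalLinear k D.Obj where
  whiskerLeft_smul X _ _ r f := Subtype.ext (MonoidalLinear.whiskerLeft_smul X.val r f.1)
  smul_whiskerRight r _ _ f X := Subtype.ext (MonoidalLinear.smul_whiskerRight r f.1 X.val)

/-- The inclusion of the morphisms of `D` into those of `C`. -/
def inclₗ (X Y : D.Obj) : (X ⟶ Y) →ₗ[k] (X.val ⟶ Y.val) := (D.hom X.val Y.val).subtype

end LinearPivotalSubcategory

/-! ### Averaging over the simple objects of `D`. -/

namespace RelativeCenter

open PivotalCategory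

variable {k : Type w} [CommRing k] {C : Type u} [Category.{v} C] [Preadditive C] [Linear k C]
  [MonoidalCategory C] [PivotalCategory C] {D : LinearPivotalSubcategory k C}

/-- The conjugate of a morphism of `C` by half braidings. -/
def twist {A B : RelativeCenter D} (f : A.obj ⟶ B.obj) (X : D.Obj) :
    A.obj ⊗ X.val ⟶ B.obj ⊗ X.val :=
  (A.σ X).hom ≫ X.val ◁ f ≫ (B.σ X).inv

variable {A B : RelativeCenter D}

theorem twist_naturality (f : A.obj ⟶ B.obj) {X Y : D.Obj} (g : X ⟶ Y) :
    A.obj ◁ g.1 ≫ twist f Y = twist f X ≫ B.obj ◁ g.1 := by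
  have h := B.naturality g
  rw [twist, twist, reassoc_of% (A.naturality g), ← cancel_mono (B.σ Y).hom]
  simp only [Category.assoc, Iso.inv_hom_id, Category.comp_id, h, Iso.inv_hom_id_assoc]
  rw [whisker_exchange]

theorem twist_tensor (f : A.obj ⟶ B.obj) (X Y : D.Obj) :
    twist f (X ⊗ Y) = (α_ A.obj X.val Y.val).inv ≫ (A.σ X).hom ▷ Y.val ≫
      (α_ X.val A.obj Y.val).hom ≫ X.val ◁ twist f Y ≫ (α_ X.val B.obj Y.val).inv ≫
        (B.σ X).inv ▷ Y.val ≫ (α_ B.obj X.val Y.val).hom := by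
  have hB : (B.σ (X ⊗ Y)).inv = (α_ X.val Y.val B.obj).hom ≫ X.val ◁ (B.σ Y).inv ≫
      (α_ X.val B.obj Y.val).inv ≫ (B.σ X).inv ▷ Y.val ≫ (α_ B.obj X.val Y.val).hom := by
    rw [← cancel_epi (B.σ (X ⊗ Y)).hom, Iso.hom_inv_id, B.monoidal]
    change 𝟙 (B.obj ⊗ X.val ⊗ Y.val) = _
    simp [← MonoidalCategory.whiskerLeft_comp_assoc, ← comp_whiskerRight_assoc]
    rfl
  rw [twist, A.monoidal, hB]
  change _ ≫ (X.val ⊗ Y.val) ◁ f ≫ _ = _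
  simp only [twist]
  monoidal

theorem twist_comp_left {A' : RelativeCenter D} (g : A' ⟶ A) (f : A.obj ⟶ B.obj) (X : D.Obj) :
    twist (A := A') (g.f ≫ f) X = g.f ▷ X.val ≫ twist f X := by
  simp only [twist, MonoidalCategory.whiskerLeft_comp, Category.assoc]
  rw [reassoc_of% (g.comm X)]

theorem twist_comp_right {B' : RelativeCenter D} (f : A.obj ⟶ B.obj) (g : B ⟶ B') (X : D.Obj) :
    twist (B := B') (f ≫ g.f) X = twist f X ≫ g.f ▷ X.val := by
  have h := g.comm X
  simp only [twist, MonoidalCategory.whiskerLeft_comp, Category.assoc]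
  congr 2
  rw [Iso.eq_inv_comp, ← Category.assoc, h]
  simp

theorem twist_hom (f : A ⟶ B) (X : D.Obj) : twist f.f X = f.f ▷ X.val := by
  rw [twist, reassoc_of% (f.comm X), Iso.hom_inv_id, Category.comp_id]

section Average

variable {I : Type*} [Fintype I] (T : I → D.Obj)
  (δ : I → k)

/-- The average of a morphism of `C` with respect to a finite family of objects of `D`. -/
noncomputable def average (f : A.obj ⟶ B.obj) : A.obj ⟶ B.obj :=
  ∑ c, δ c • ptrR (T c).val (twist f (T c))

theorem average_comp_left {A' : RelativeCenter D} (g : A' ⟶ A) (f : A.obj ⟶ B.obj) :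
    average (A := A') T δ (g.f ≫ f) = g.f ≫ average T δ f := by
  simp only [average, Preadditive.comp_sum, twist_comp_left, ptrR_whiskerRight_comp,
    Linear.comp_smul]

theorem average_comp_right {B' : RelativeCenter D} (f : A.obj ⟶ B.obj) (g : B ⟶ B') :
    average (B := B') T δ (f ≫ g.f) = average T δ f ≫ g.f := by
  simp only [average, Preadditive.sum_comp, twist_comp_right, ptrR_comp_whiskerRight,
    Linear.smul_comp]

variable {T δ} [MonoidalPreadditive C] [MonoidalLinear k C]

theorem average_hom (f : A ⟶ B) {ε : I → k} (hε : ∀ c, dimR (T c) = ε c • 𝟙 (𝟙_ D.Obj)) :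
    average T δ f.f = (∑ c, δ c * ε c) • f.f := by
  rw [average, Finset.sum_smul]
  refine Finset.sum_congr rfl fun c _ => ?_
  have h : dimR (T c).val = ε c • 𝟙 (𝟙_ C) := congrArg Subtype.val (hε c)
  rw [twist_hom, ptrR_whiskerRight_eq_smul f.f h, mul_smul]

/-- The value of `sandwich` at the morphisms of `D`. -/
noncomputable def sandwichTwist (f : A.obj ⟶ B.obj) (X j Z : D.Obj) :
    (X ⟶ j ⊗ Z) →ₗ[k] (j ⊗ Z ⟶ X) →ₗ[k] (A.obj ⊗ X.val ⟶ B.obj ⊗ X.val) :=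
  (sandwichₗ k X.val Z.val (twist f j)).compl₁₂ (D.inclₗ X (j ⊗ Z)) (D.inclₗ (j ⊗ Z) X)

/-- A resolution of `X ⊗ i` in `D` is inserted after the twist; since its morphisms lie in `D`,
naturality moves each projection in front, leaving the twist at `T j`. -/
theorem ptrRTensor_twist (f : A.obj ⟶ B.obj) (X i : D.Obj) (r : FamilyResolution T (X ⊗ i)) :
    ptrRTensor X.val i.val (twist f (X ⊗ i)) = ∑ j, ∑ a, sandwichTwist f X (T j) (dual i)
      (bendInRight k X i (T j) (r.p j a)) (bendOutRight k X i (T j) (r.q j a)) := by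
  have h1 : ∑ j, ∑ a, (r.p j a).1 ≫ (r.q j a).1 = 𝟙 (X ⊗ i).val := by
    have := congrArg (D.inclₗ (X ⊗ i) (X ⊗ i)) r.total
    simp only [map_sum] at this
    exact this
  have h : twist f (X ⊗ i) = ∑ j, ∑ a,
      A.obj ◁ (r.p j a).1 ≫ twist f (T j) ≫ B.obj ◁ (r.q j a).1 := by
    rw [← Category.comp_id (twist f (X ⊗ i)), ← whiskerLeft_id, ← h1]
    simp only [whiskerLeft_sum, Preadditive.comp_sum, MonoidalCategory.whiskerLeft_comp]
    refine Finset.sum_congr rfl fun j _ => Finset.sum_congr rfl fun a _ => ?_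
    rw [← Category.assoc (A.obj ◁ _), twist_naturality, Category.assoc]
  rw [h]
  change ptrRTensorₗ k A.obj B.obj X.val i.val _ = _
  simp only [map_sum]
  refine Finset.sum_congr rfl fun j _ => Finset.sum_congr rfl fun a _ => ?_
  exact ptrRTensor_conj (k := k) _ _ _

theorem ptrR_twist_whiskerRight (f : A.obj ⟶ B.obj) (X j : D.Obj)
    (r : FamilyResolution (fun c => dual (T c)) (dual j ⊗ X)) :
    ptrR j.val (twist f j) ▷ X.val = ∑ i, ∑ b, sandwichTwist f X j (dual (T i))
      (bendInLeft k X j (dual (T i)) (r.p i b)) (bendOutLeft k X j (dual (T i)) (r.q i b)) := by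
  have h1 : ∑ i, ∑ b, (r.p i b).1 ≫ (r.q i b).1 = 𝟙 (dual j.val ⊗ X.val) := by
    have := congrArg (D.inclₗ (dual j ⊗ X) (dual j ⊗ X)) r.total
    simp only [map_sum] at this
    exact this
  rw [ptrR_whiskerRight (k := k)]
  conv_lhs => enter [3]; rw [← h1]
  change sandwichₗ k X.val (dual j.val ⊗ X.val) (twist f j) _ _ = _
  simp only [map_sum]
  refine Finset.sum_congr rfl fun i _ => Finset.sum_congr rfl fun b _ => ?_
  exact (sandwich_bendLeft (k := k) (twist f j) (r.p i b).1 (r.q i b).1).symm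

end Average

section Field

variable {k : Type w} [Field k] {C : Type u} [Category.{v} C] [Preadditive C] [Linear k C]
  [MonoidalCategory C] [PivotalCategory C] {D : LinearPivotalSubcategory k C}
  [MonoidalPreadditive C] [MonoidalLinear k C] {A B : RelativeCenter D}

/-- Conjugating the `i`-th partial trace by the half braidings at `X` gives the partial trace over
`i` of the twist at `X ⊗ i`. Both sides then become double sums over pairs `(i, j)`, weighted by `δ
i` on the left and `δ j` on the right, and `smul_sum_bend_eq` matches them pair by pair. -/
theorem average_mem (hD : IsSplitSemisimple k D.Obj) (hone : 𝟙 (𝟙_ C) ≠ 0) {I : Type*}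
    [Fintype I] {T : I → D.Obj} (hT : IsCompleteSimpleFamily k T) {δ : I → k}
    (hδ : ∀ c, dimL (T c) = δ c • 𝟙 (𝟙_ D.Obj)) (f : A.obj ⟶ B.obj) :
    average T δ f ∈ homSubmodule A B := by
  intro X
  rw [← Iso.comp_inv_eq, Category.assoc]
  have hX : X.val ◁ average T δ f =
      ∑ c, δ c • X.val ◁ ptrR (T c).val (twist f (T c)) := by
    simp [average, whiskerLeft_sum]
  have hX' : average T δ f ▷ X.val =
      ∑ c, δ c • ptrR (T c).val (twist f (T c)) ▷ X.val := by
    simp [average, sum_whiskerRight]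
  rw [hX, hX', Preadditive.sum_comp, Preadditive.comp_sum]
  simp only [Linear.smul_comp, Linear.comp_smul, conj_ptrR, ← twist_tensor]
  have r i := (hT.nonempty_resolution hD (X ⊗ T i)).some
  have r' j := (hT.dual.nonempty_resolution hD (dual (T j) ⊗ X)).some
  simp only [fun i => ptrRTensor_twist f X (T i) (r i),
    fun j => ptrR_twist_whiskerRight f X (T j) (r' j), Finset.smul_sum]
  rw [Finset.sum_comm]
  refine Finset.sum_congr rfl fun j _ => Finset.sum_congr rfl fun i _ => ?_
  rw [← Finset.smul_sum, ← Finset.smul_sum]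
  refine smul_sum_bend_eq (fun c hc => ?_) (isSplitSimple_iff.1 (hT.simple j)).2
    (isSplitSimple_iff.1 (hT.dual.simple i)).2 (hδ i) (hδ j) _ _
    (hT.sum_comp_resolution (r i)) _ _ (hT.dual.sum_resolution_comp (r' j)) _
  have : c • 𝟙 (𝟙_ C) = 0 := congrArg Subtype.val hc
  exact (smul_eq_zero.1 this).resolve_right hone

end Field

end RelativeCenter

-- A pseudoinverse in `C` is averaged and divided by the dimension of `D`.
open PivotalCategory RelativeCenter in
theorem RelativeCenter.exists_pseudoinverse {k : Type w} [Field k] {C : Type u} [Category.{v} C]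
    [Preadditive C] [Linear k C] [MonoidalCategory C] [MonoidalPreadditive C]
    [MonoidalLinear k C] [PivotalCategory C] (hC : IsSplitSemisimple k C)
    (hunit : IsSplitSimple k (𝟙_ C)) {D : LinearPivotalSubcategory k C}
    (hD : IsSplitSemisimple k D.Obj) (hfin : Finite (SimpleClasses k D.Obj))
    (hdim : pivotalDim k D.Obj ≠ 0) {A B : RelativeCenter D} (f : A ⟶ B) :
    ∃ g : B ⟶ A, f ≫ g ≫ f = f := by
  have := Fintype.ofFinite (SimpleClasses k D.Obj)
  -- Simplicity of the unit of `C` makes all dimensions in `D` scalars, although `D` need not be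
  -- full.
  have hscalar : ∀ e : 𝟙_ D.Obj ⟶ 𝟙_ D.Obj, ∃ c : k, e = c • 𝟙 (𝟙_ D.Obj) := fun e => by
    obtain ⟨c, hc⟩ := (isSplitSimple_iff.1 hunit).2 e.1
    exact ⟨c, Subtype.ext hc⟩
  let T : SimpleClasses k D.Obj → D.Obj := fun c => c.1.out
  choose δ hδ using fun c => hscalar (dimL (T c))
  choose ε hε using fun c => hscalar (dimR (T c))
  have hs : pivotalDim k D.Obj = (∑ c, δ c * ε c) • 𝟙 (𝟙_ D.Obj) := by
    rw [pivotalDim, finsum_eq_sum_of_fintype, Finset.sum_smul]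
    refine Finset.sum_congr rfl fun c _ => ?_
    change dimR (T c) ≫ dimL (T c) = _
    rw [hδ, hε, Linear.smul_comp, Linear.comp_smul, Category.id_comp, smul_smul, mul_comm]
  set s := ∑ c, δ c * ε c with hsdef
  have hs0 : s ≠ 0 := fun h => hdim (by rw [hs, h, zero_smul])
  obtain ⟨g, hg⟩ := hC.exists_pseudoinverse f.f
  have hT := isCompleteSimpleFamily_out hD
  let g' : B ⟶ A := ⟨average T δ g, average_mem hD (isSplitSimple_iff.1 hunit).1 hT hδ g⟩
  have key : f ≫ g' ≫ f = s • f := by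
    apply hom_ext
    change f.f ≫ average T δ g ≫ f.f = s • f.f
    rw [← average_comp_right, ← average_comp_left, hg, average_hom f hε]
  refine ⟨s⁻¹ • g', ?_⟩
  rw [Linear.smul_comp, Linear.comp_smul, key, smul_smul, inv_mul_cancel₀ hs0, one_smul]

theorem lemma4p5 {k : Type w} [Field k] [IsAlgClosed k] {C : Type u} [Category.{v} C]
    [Preadditive C] [Linear k C] [MonoidalCategory C] [MonoidalPreadditive C]
    [MonoidalLinear k C] [PivotalCategory C] (hC : IsSplitSemisimple k C)
    (hunit : IsSplitSimple k (𝟙_ C)) (D : LinearPivotalSubcategory k C)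
    (hD : IsSplitSemisimple k D.Obj) (hfin : Finite (SimpleClasses k D.Obj))
    (hdim : pivotalDim k D.Obj ≠ 0) :
    IsSplitSemisimple k (RelativeCenter D) := by
  have := hC.isIdempotentComplete
  have := hC.hasFiniteBiproducts
  refine isSplitSemisimple_of_pseudoinverse
    (fun f => RelativeCenter.exists_pseudoinverse hC hunit hD hfin hdim f) (fun A => ?_)
    RelativeCenter.hasFiniteBiproducts
  have := hC.finite_hom A.obj A.obj
  exact Module.Finite.of_injective (RelativeCenter.forgetₗ k A A)
    fun f g h => RelativeCenter.hom_ext h
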